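/- All graphs are finite, simple and have at least one vertex; only role graphs may have loops (but no multiple edges). For a graph $G$ with complement $\overline{G}$, the complementary prism $G\overline{G}$ is the disjoint union of $G$ and $\overline{G}$ together with the edges $v\overline{v}$ joining each vertex $v$ of $G$ to the corresponding vertex $\overline{v}$ of $\overline{G}$. An $r$-role assignment of a graph $H$ is a surjective map $p:V(H)\to V(R)$, where $R$ is some graph, possibly with loops, with $|V(R)|=r$, such that $p(N_H(v))=N_R(p(v))$ for every $v\in V(H)$. Write $K_n$ for the complete graph on $n$ vertices, $K_{n,m}$ for the complete bipartite graph with parts of sizes $n$ and $m$, $\cup$ for disjoint union, and $K_2^t$ for the disjoint union of $t$ copies of $K_2$. A connected component is non-trivial if it has at least two vertices. Theorem. Let $G$ be a bipartite graph. Then $G\overline{G}$ has a $3$-role assignment if and only if $G$ is none of the following, up to isomorphism: 1. $K_2$, or $\overline{K_n}$ with $n\ge 2$; 2. a graph with at least one isolated vertex, every non-trivial connected component of which is isomorphic to $K_{n,m}$ for some $n,m\ge 1$, with the exception of the graphs $K_1\cup K_{1,m}$ with $m\ge 1$; 3. $K_2^t$ with $t\ge 4$; 4. $\bigcup_{i=1}^t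 K_{1,m_i}$ with $t\ge 3$, all $m_i\ge 1$ and at least one $m_i\ge 2$; 5. $K_{1,m_1}\cup K_{1,m_2}$ with $m_1,m_2\ge 2$. -/

import Mathlib

namespace RoleAssignment

/-- A graph in which loops are allowed (and multiple edges are not). -/
structure LoopGraph (W : Type*) where
  Adj : W → W → Prop
  symm : ∀ a b, Adj a b → Adj b a

/-- The neighbourhood `N_R(a)`; it contains `a` exactly when there is a loop at `a`. -/
def LoopGraph.neighborSet {W : Type*} (R : LoopGraph W) (a : W) : Set W :=
  {b | R.Adj a b}

/-- `p` is an `R`-role assignment of `G`: a surjective map with `p(N_G(v)) = N_R(p(v))` for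
every vertex `v`. -/
def IsRoleAssignment {V W : Type*} (G : SimpleGraph V) (R : LoopGraph W) (p : V → W) : Prop :=
  Function.Surjective p ∧ ∀ v : V, p '' G.neighborSet v = R.neighborSet (p v)

/-- `G` has an `r`-role assignment: an `R`-role assignment for some graph `R`, possibly with
loops, on `r` vertices. -/
def HasRoleAssignment {V : Type*} (G : SimpleGraph V) (r : ℕ) : Prop :=
  ∃ (R : LoopGraph (Fin r)) (p : V → Fin r), IsRoleAssignment G R p

/-- The complementary prism of `G`: the disjoint union of `G` (on the vertices `inl v`) and its
complement (on the vertices `inr v`), together with the edges joining `inl v` to `inr v`. -/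
def complementaryPrism {V : Type*} (G : SimpleGraph V) : SimpleGraph (V ⊕ V) where
  Adj
    | Sum.inl u, Sum.inl v => G.Adj u v
    | Sum.inr u, Sum.inr v => Gᶜ.Adj u v
    | Sum.inl u, Sum.inr v => u = v
    | Sum.inr u, Sum.inl v => u = v
  symm.symm
    | Sum.inl _, Sum.inl _ => fun h => G.adj_symm h
    | Sum.inr _, Sum.inr _ => fun h => Gᶜ.adj_symm h
    | Sum.inl _, Sum.inr _ => fun h => h.symm
    | Sum.inr _, Sum.inl _ => fun h => h.symm
  loopless.irrefl
    | Sum.inl _ => G.irrefl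
    | Sum.inr _ => Gᶜ.irrefl

/-- The disjoint union of a family of graphs. -/
def disjointUnion {ι : Type*} {V : ι → Type*} (G : ∀ i, SimpleGraph (V i)) :
    SimpleGraph (Σ i, V i) where
  Adj x y := ∃ (i : ι) (a b : V i), (G i).Adj a b ∧ x = ⟨i, a⟩ ∧ y = ⟨i, b⟩
  symm.symm := by
    rintro _ _ ⟨i, a, b, h, rfl, rfl⟩
    exact ⟨i, b, a, h.symm, rfl, rfl⟩
  loopless.irrefl := by
    rintro _ ⟨i, a, b, h, rfl, hab⟩
    obtain rfl : a = b := by simpa using hab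
    exact (G i).irrefl h

/-- The complete graph `K_n`. -/
abbrev K (n : ℕ) : SimpleGraph (Fin n) := ⊤

/-- The complete bipartite graph `K_{n,m}`. -/
abbrev KBip (n m : ℕ) : SimpleGraph (Fin n ⊕ Fin m) := completeBipartiteGraph (Fin n) (Fin m)

/-- `G` and `H` are isomorphic. -/
def Isomorphic {V W : Type*} (G : SimpleGraph V) (H : SimpleGraph W) : Prop :=
  Nonempty (G ≃g H)

/-- `G` has an isolated vertex and each of its non-trivial connected components (those with at
least two vertices) is isomorphic to some `K_{n,m}` with `n, m ≥ 1`, but `G` is not isomorphic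
to `K_1 ∪ K_{1,m}` for any `m ≥ 1`. -/
def IsolatedCompleteBipartite {V : Type*} (G : SimpleGraph V) : Prop :=
  (∃ v, G.IsIsolated v) ∧
  (∀ C : G.ConnectedComponent, C.supp.Nontrivial →
    ∃ n m : ℕ, 1 ≤ n ∧ 1 ≤ m ∧ Isomorphic C.toSimpleGraph (KBip n m)) ∧
  ¬ ∃ m : ℕ, 1 ≤ m ∧ Isomorphic G (K 1 ⊕g KBip 1 m)

end RoleAssignment

namespace RoleAssignment

/-! Sufficiency. Suppose the prism has no 3-role assignment. Explicit assignments, all on a path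
with loops, then restrict `G` more and more. Strict inclusion between neighbourhoods of non-isolated
vertices is impossible (`nbhdAntichain_of_not_hasRoleAssignment`). If `G` has an isolated vertex,
vertices with a common neighbour are twins (`nbhdTwins_of_not_hasRoleAssignment`), so non-trivial
components are complete bipartite. If it has none, every edge has an end of degree one
(`star_of_not_hasRoleAssignment`), so `G` is a forest of stars. The remaining graphs with an
assignment, namely `K_1 ∪ K_{1,m}`, one star with at least two leaves, `K_2 ∪ K_{1,m}` and three
copies of `K_2`, are treated by hand.

Necessity. An isolated vertex `i` gives a vertex of degree one in the prism, so its role has a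
single neighbour in the role graph; case analysis on the other adjacencies leaves only graphs in
which some vertex is adjacent to all others but `i` (`PrismRole.star_of_isolated`). For star
forests, a leaf has degree two in the prism and so sees at most two roles, while the complement is
dense. If two roles are nonadjacent, the role graph is a path, excluded by `PrismRole.path_false`;
if distinct roles are always adjacent, the number of loops decides
(`PrismRole.false_of_starForest`). `K_2` is checked directly. -/

/-- A role assignment of the complementary prism of `G`, described by its restriction `f` to `G`
and its restriction `g` to the complement of `G`. -/
structure PrismRole {V W : Type*} (G : SimpleGraph V) (R : W → W → Prop) (f g : V → W) : Prop where
  symm : ∀ a b, R a b → R b a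
  surj : ∀ c, ∃ v, f v = c ∨ g v = c
  left : ∀ v w, G.Adj v w → R (f v) (f w)
  mid : ∀ v, R (f v) (g v)
  right : ∀ v w, v ≠ w → ¬ G.Adj v w → R (g v) (g w)
  left_ex : ∀ v c, R (f v) c → g v = c ∨ ∃ w, G.Adj v w ∧ f w = c
  right_ex : ∀ v c, R (g v) c → f v = c ∨ ∃ w, v ≠ w ∧ ¬ G.Adj v w ∧ g w = c

theorem hasRoleAssignment_prism_iff {V : Type*} {G : SimpleGraph V} :
    HasRoleAssignment (complementaryPrism G) 3 ↔
      ∃ (R : Fin 3 → Fin 3 → Prop) (f g : V → Fin 3), PrismRole G R f g := by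
  constructor
  · rintro ⟨R, p, hs, hp⟩
    have key : ∀ v c, R.Adj (p v) c ↔ ∃ w, (complementaryPrism G).Adj v w ∧ p w = c := by
      intro v c
      have := Set.ext_iff.1 (hp v) c
      simpa [LoopGraph.neighborSet] using this.symm
    refine ⟨R.Adj, fun v => p (.inl v), fun v => p (.inr v), R.symm, ?_, ?_, ?_, ?_, ?_, ?_⟩
    · intro c
      obtain ⟨v | v, hv⟩ := hs c
      exacts [⟨v, .inl hv⟩, ⟨v, .inr hv⟩]
    · exact fun v w h => (key _ _).2 ⟨.inl w, h, rfl⟩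
    · exact fun v => (key _ _).2 ⟨.inr v, rfl, rfl⟩
    · exact fun v w h h' => (key _ _).2 ⟨.inr w, (SimpleGraph.compl_adj _ _ _).2 ⟨h, h'⟩, rfl⟩
    · intro v c h
      obtain ⟨w | w, hw, hc⟩ := (key _ _).1 h
      · exact .inr ⟨w, hw, hc⟩
      · obtain rfl : v = w := hw
        exact .inl hc
    · intro v c h
      obtain ⟨w | w, hw, hc⟩ := (key _ _).1 h
      · obtain rfl : v = w := hw
        exact .inl hc
      · have := (SimpleGraph.compl_adj _ _ _).1 (show Gᶜ.Adj v w from hw)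
        exact .inr ⟨w, this.1, this.2, hc⟩
  · rintro ⟨R, f, g, h⟩
    refine ⟨⟨R, h.symm⟩, Sum.elim f g, ?_, ?_⟩
    · intro c
      obtain ⟨v, hv | hv⟩ := h.surj c
      exacts [⟨.inl v, hv⟩, ⟨.inr v, hv⟩]
    · rintro (v | v) <;> ext c <;> constructor
      · rintro ⟨w | w, hw, rfl⟩
        · exact h.left v w hw
        · obtain rfl : v = w := hw
          exact h.mid v
      · intro hc
        rcases h.left_ex v c hc with h' | ⟨w, hw, h'⟩
        · exact ⟨.inr v, rfl, h'⟩
        · exact ⟨.inl w, hw, h'⟩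
      · rintro ⟨w | w, hw, rfl⟩
        · obtain rfl : v = w := hw
          exact h.symm _ _ (h.mid v)
        · have := (SimpleGraph.compl_adj _ _ _).1 (show Gᶜ.Adj v w from hw)
          exact h.right v w this.1 this.2
      · intro hc
        rcases h.right_ex v c hc with h' | ⟨w, hw, hw', h'⟩
        · exact ⟨.inl v, rfl, h'⟩
        · exact ⟨.inr w, (SimpleGraph.compl_adj _ _ _).2 ⟨hw, hw'⟩, h'⟩

/-- A role assignment of a complementary prism is carried along an isomorphism. -/
theorem PrismRole.of_iso {V V' W : Type*} {G : SimpleGraph V} {H : SimpleGraph V'}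
    {R : W → W → Prop} {f g : V → W} (h : PrismRole G R f g) (e : H ≃g G) :
    PrismRole H R (f ∘ e) (g ∘ e) where
  symm := h.symm
  surj c := by
    obtain ⟨v, hv⟩ := h.surj c
    exact ⟨e.symm v, by simpa using hv⟩
  left v w hvw := h.left _ _ (e.map_adj_iff.2 hvw)
  mid v := h.mid _
  right v w hne hvw := h.right _ _ (e.injective.ne hne) (fun h' => hvw (e.map_adj_iff.1 h'))
  left_ex v c hc := by
    rcases h.left_ex _ _ hc with h' | ⟨w, hw, h'⟩
    · exact .inl h'
    · exact .inr ⟨e.symm w, by rw [← e.map_adj_iff]; simpa using hw, by simpa using h'⟩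
  right_ex v c hc := by
    rcases h.right_ex _ _ hc with h' | ⟨w, hw, hw', h'⟩
    · exact .inl h'
    · refine .inr ⟨e.symm w, ?_, by rw [← e.map_adj_iff]; simpa using hw', by simpa using h'⟩
      rintro rfl
      simp at hw

theorem hasRoleAssignment_prism_of_iso {V V' : Type*} {G : SimpleGraph V} {H : SimpleGraph V'}
    (e : G ≃g H) (h : HasRoleAssignment (complementaryPrism G) 3) :
    HasRoleAssignment (complementaryPrism H) 3 := by
  obtain ⟨R, f, g, hR⟩ := hasRoleAssignment_prism_iff.1 h
  exact hasRoleAssignment_prism_iff.2 ⟨R, _, _, hR.of_iso e.symm⟩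

/-! ### Explicit role assignments on two role graphs -/

/-- The path `1 - 0 - 2` with loops at `0` and at `1`. -/
def twoLoopPath (a b : Fin 3) : Prop := a = 0 ∨ b = 0 ∨ (a = 1 ∧ b = 1)

/-- The path `1 - 0 - 2` with a loop at `1`. -/
def endLoopPath (a b : Fin 3) : Prop := (a = 0 ∧ b ≠ 0) ∨ (a ≠ 0 ∧ b = 0) ∨ (a = 1 ∧ b = 1)

theorem PrismRole.of_twoLoopPath {V : Type*} {G : SimpleGraph V} {f g : V → Fin 3}
    (surj : ∀ c, ∃ v, f v = c ∨ g v = c)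
    (left : ∀ v w, G.Adj v w → f v = 2 → f w = 0)
    (mid : ∀ v, f v = 2 → g v = 0) (mid' : ∀ v, g v = 2 → f v = 0)
    (right : ∀ v w, v ≠ w → ¬ G.Adj v w → g v = 2 → g w = 0)
    (left_zero : ∀ v, g v = 0 ∨ ∃ w, G.Adj v w ∧ f w = 0)
    (left_one : ∀ v, f v ≠ 2 → g v = 1 ∨ ∃ w, G.Adj v w ∧ f w = 1)
    (left_two : ∀ v, f v = 0 → g v = 2 ∨ ∃ w, G.Adj v w ∧ f w = 2)
    (right_zero : ∀ v, f v = 0 ∨ ∃ w, v ≠ w ∧ ¬ G.Adj v w ∧ g w = 0)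
    (right_one : ∀ v, g v ≠ 2 → f v = 1 ∨ ∃ w, v ≠ w ∧ ¬ G.Adj v w ∧ g w = 1)
    (right_two : ∀ v, g v = 0 → f v = 2 ∨ ∃ w, v ≠ w ∧ ¬ G.Adj v w ∧ g w = 2) :
    PrismRole G twoLoopPath f g := by
  have key : ∀ a b : Fin 3, (a = 2 → b = 0) → (b = 2 → a = 0) → twoLoopPath a b := by
    unfold twoLoopPath; decide
  have h1 : ∀ a : Fin 3, twoLoopPath a 1 → a ≠ 2 := by unfold twoLoopPath; decide
  have h2 : ∀ a : Fin 3, twoLoopPath a 2 → a = 0 := by unfold twoLoopPath; decide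
  refine ⟨by unfold twoLoopPath; decide, surj, fun v w h => key _ _ (left v w h) (left w v h.symm),
    fun v => key _ _ (mid v) (mid' v),
    fun v w h h' => key _ _ (right v w h h') (right w v h.symm fun h'' => h' h''.symm), ?_, ?_⟩
  · intro v c h
    fin_cases c
    exacts [left_zero v, left_one v (h1 _ h), left_two v (h2 _ h)]
  · intro v c h
    fin_cases c
    exacts [right_zero v, right_one v (h1 _ h), right_two v (h2 _ h)]

theorem PrismRole.of_endLoopPath {V : Type*} {G : SimpleGraph V} {f g : V → Fin 3}
    (surj : ∀ c, ∃ v, f v = c ∨ g v = c)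
    (left : ∀ v w, G.Adj v w → (f v = 0 → f w ≠ 0) ∧ (f v = 2 → f w = 0))
    (mid : ∀ v, (f v = 0 → g v ≠ 0) ∧ (f v = 2 → g v = 0) ∧ (g v = 2 → f v = 0))
    (right : ∀ v w, v ≠ w → ¬ G.Adj v w → (g v = 0 → g w ≠ 0) ∧ (g v = 2 → g w = 0))
    (left_zero : ∀ v, f v ≠ 0 → g v = 0 ∨ ∃ w, G.Adj v w ∧ f w = 0)
    (left_one : ∀ v, f v ≠ 2 → g v = 1 ∨ ∃ w, G.Adj v w ∧ f w = 1)
    (left_two : ∀ v, f v = 0 → g v = 2 ∨ ∃ w, G.Adj v w ∧ f w = 2)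
    (right_zero : ∀ v, g v ≠ 0 → f v = 0 ∨ ∃ w, v ≠ w ∧ ¬ G.Adj v w ∧ g w = 0)
    (right_one : ∀ v, g v ≠ 2 → f v = 1 ∨ ∃ w, v ≠ w ∧ ¬ G.Adj v w ∧ g w = 1)
    (right_two : ∀ v, g v = 0 → f v = 2 ∨ ∃ w, v ≠ w ∧ ¬ G.Adj v w ∧ g w = 2) :
    PrismRole G endLoopPath f g := by
  have key : ∀ a b : Fin 3, (a = 0 → b ≠ 0) → (a = 2 → b = 0) → (b = 2 → a = 0) →
      endLoopPath a b := by
    unfold endLoopPath; decide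
  have h0 : ∀ a : Fin 3, endLoopPath a 0 → a ≠ 0 := by unfold endLoopPath; decide
  have h1 : ∀ a : Fin 3, endLoopPath a 1 → a ≠ 2 := by unfold endLoopPath; decide
  have h2 : ∀ a : Fin 3, endLoopPath a 2 → a = 0 := by unfold endLoopPath; decide
  refine ⟨by unfold endLoopPath; decide, surj,
    fun v w h => key _ _ (left v w h).1 (left v w h).2 (left w v h.symm).2,
    fun v => key _ _ (mid v).1 (mid v).2.1 (mid v).2.2,
    fun v w h h' => key _ _ (right v w h h').1 (right v w h h').2
      (right w v h.symm fun h'' => h' h''.symm).2, ?_, ?_⟩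
  · intro v c h
    fin_cases c
    exacts [left_zero v (h0 _ h), left_one v (h1 _ h), left_two v (h2 _ h)]
  · intro v c h
    fin_cases c
    exacts [right_zero v (h0 _ h), right_one v (h1 _ h), right_two v (h2 _ h)]

open Classical in
/-- The main family of role assignments: `a` and `s` have a common neighbour, and `a` has a
neighbour that `s` does not have. -/
theorem prismRole_of_not_nbhd_subset {V : Type*} {G : SimpleGraph V} {a s n₀ n₁ : V}
    (hbip : G.IsBipartite)
    (ha₀ : G.Adj a n₀) (hs₀ : G.Adj s n₀) (ha₁ : G.Adj a n₁) (hs₁ : ¬ G.Adj s n₁)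
    (hU : ∀ u, G.Adj s u → ¬ G.Adj a u → ∃ w, G.Adj u w ∧ ∃ t, G.Adj w t ∧ ¬ G.Adj s t)
    (hM : ∀ u, u ≠ a → ¬ G.Adj a u → ∃ w, w ≠ a ∧ w ≠ u ∧ ¬ G.Adj a w ∧ ¬ G.Adj u w) :
    ∃ f g, PrismRole G twoLoopPath f g := by
  obtain ⟨κ⟩ := hbip
  have hκ : ∀ v w, G.Adj v w → κ v ≠ κ w := fun v w h => κ.valid h
  have htri : ∀ v w z, G.Adj v w → G.Adj v z → ¬ G.Adj w z := by
    intro v w z h1 h2 h3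
    have := hκ _ _ h1; have := hκ _ _ h2; have := hκ _ _ h3; omega
  have hc : ∀ v w, G.Adj v w → G.Adj w v := fun _ _ => SimpleGraph.Adj.symm
  have hsa : s ≠ a := by rintro rfl; exact hs₁ ha₁
  have hnas : ¬ G.Adj a s := fun h => htri _ _ _ h ha₀ hs₀
  have hnsa : ¬ G.Adj s a := fun h => hnas h.symm
  -- Role 2 on `s` forces role 0 on its neighbours. Role 2 must go to every vertex with
  -- neighbourhood inside that of `s`: its neighbours all have role 0, so role 1 would lack a
  -- neighbour of role 1. In the complement only `a` has role 2.
  let f : V → Fin 3 := fun w => if w = a ∨ G.Adj s w then 0 else if G.Adj a w then 1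
    else if ∀ t, G.Adj w t → G.Adj s t then 2 else 1
  let g : V → Fin 3 := fun w => if w = a then 2 else if G.Adj a w then 1 else 0
  have f0 : ∀ w, f w = 0 ↔ w = a ∨ G.Adj s w := by intro w; simp only [f]; grind
  have f2 : ∀ w, f w = 2 ↔ w ≠ a ∧ ∀ t, G.Adj w t → G.Adj s t := by
    intro w; simp only [f]; grind
  have f1 : ∀ w, f w = 1 ↔ w ≠ a ∧ ¬ G.Adj s w ∧ ∃ t, G.Adj w t ∧ ¬ G.Adj s t := by
    intro w; simp only [f]; grind
  have g0 : ∀ w, g w = 0 ↔ w ≠ a ∧ ¬ G.Adj a w := by intro w; simp only [g]; grind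
  have g1 : ∀ w, g w = 1 ↔ G.Adj a w := by
    intro w; simp only [g]; have := G.irrefl (v := a); grind
  have g2 : ∀ w, g w = 2 ↔ w = a := by intro w; simp only [g]; grind
  clear_value f g
  refine ⟨f, g, PrismRole.of_twoLoopPath ?_ ?_ ?_ ?_ ?_ ?_ ?_ ?_ ?_ ?_ ?_⟩
  · intro c; fin_cases c
    exacts [⟨a, .inl ((f0 _).2 (.inl rfl))⟩, ⟨n₁, .inr ((g1 _).2 ha₁)⟩, ⟨a, .inr ((g2 _).2 rfl)⟩]
  · intro v w h h'
    exact (f0 w).2 (.inr (((f2 _).1 h').2 _ h))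
  · intro v h
    exact (g0 v).2 ⟨((f2 _).1 h).1, fun h' => hnsa (((f2 _).1 h).2 _ h'.symm)⟩
  · intro v h
    exact (f0 v).2 (.inl ((g2 v).1 h))
  · intro v w hne h h'
    obtain rfl := (g2 v).1 h'
    exact (g0 w).2 ⟨hne.symm, h⟩
  · intro v
    by_cases hv : v = a
    · subst hv; exact .inr ⟨n₀, ha₀, (f0 _).2 (.inr hs₀)⟩
    by_cases h : G.Adj a v
    · exact .inr ⟨a, h.symm, (f0 _).2 (.inl rfl)⟩
    · exact .inl ((g0 v).2 ⟨hv, h⟩)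
  · intro v h
    by_cases hv : v = a
    · subst hv
      exact .inr ⟨n₁, ha₁, (f1 _).2 ⟨ha₁.ne', hs₁, v, ha₁.symm, hnsa⟩⟩
    by_cases h' : G.Adj a v
    · exact .inl ((g1 v).2 h')
    · right
      by_cases hsv : G.Adj s v
      -- A neighbour of `v` that has a neighbour outside that of `s` escapes role 2, hence has role
      -- 1.
      · obtain ⟨w, hw, hw'⟩ := hU v hsv h'
        exact ⟨w, hw, (f1 w).2 ⟨fun e => h' (e ▸ hw.symm), fun e => htri _ _ _ hsv e hw, hw'⟩⟩
      · have : ∃ t, G.Adj v t ∧ ¬ G.Adj s t := by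
          by_contra hcon
          exact h ((f2 v).2 ⟨hv, fun t ht => by_contra fun e => hcon ⟨t, ht, e⟩⟩)
        obtain ⟨t, ht, hst⟩ := this
        exact ⟨t, ht, (f1 t).2 ⟨fun e => h' (e ▸ ht.symm), hst, v, ht.symm, hsv⟩⟩
  · intro v h
    rcases (f0 v).1 h with rfl | h
    · exact .inl ((g2 _).2 rfl)
    · exact .inr ⟨s, h.symm, (f2 _).2 ⟨hsa, fun _ => id⟩⟩
  · intro v
    by_cases hv : v = a ∨ G.Adj s v
    · exact .inl ((f0 v).2 hv)
    right
    push Not at hv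
    -- The copy of `s` in the complement serves everyone nonadjacent to `s`, except `s` itself; for
    -- `s` the witness comes from `hM`.
    by_cases h : v = s
    · obtain ⟨w, hw⟩ := hM s hsa hnas
      exact ⟨w, h ▸ hw.2.1.symm, h ▸ hw.2.2.2, (g0 w).2 ⟨hw.1, hw.2.2.1⟩⟩
    · exact ⟨s, h, fun e => hv.2 e.symm, (g0 s).2 ⟨hsa, hnas⟩⟩
  · intro v h
    have hva : v ≠ a := fun e => h ((g2 v).2 e)
    by_cases h' : G.Adj a v
    · by_cases hv : v = n₀
      · subst hv
        exact .inr ⟨n₁, fun e => hs₁ (e ▸ hs₀), htri _ _ _ h' ha₁, (g1 _).2 ha₁⟩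
      · exact .inr ⟨n₀, hv, htri _ _ _ h' ha₀, (g1 _).2 ha₀⟩
    -- One of the copies of `n₀`, `n₁` serves, unless `v` is adjacent to both; then `v` itself has
    -- role 0 or 1, and 0 would give a triangle on `s`, `v`, `n₀`.
    · by_cases h1 : G.Adj v n₁
      · by_cases h0 : G.Adj v n₀
        · by_cases hsv : G.Adj s v
          · exact absurd h0 (htri _ _ _ hsv hs₀)
          · exact .inl ((f1 v).2 ⟨hva, hsv, n₁, h1, hs₁⟩)
        · exact .inr ⟨n₀, fun e => h' (e ▸ ha₀), h0, (g1 _).2 ha₀⟩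
      · exact .inr ⟨n₁, fun e => h' (e ▸ ha₁), h1, (g1 _).2 ha₁⟩
  · intro v h
    obtain ⟨h1, h2⟩ := (g0 v).1 h
    exact .inr ⟨a, h1, fun e => h2 e.symm, (g2 a).2 rfl⟩

-- The ends of the edge get role 0 in `G` and 2 in the complement, all other vertices 1 and 0. The
-- last two hypotheses say that deleting `a` and `b` leaves neither an isolated nor a universal
-- vertex.
open Classical in
theorem prismRole_of_edge {V : Type*} {G : SimpleGraph V} {a b : V} (hab : G.Adj a b)
    (htri : ∀ v, ¬ (G.Adj v a ∧ G.Adj v b))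
    (ha : ∃ c, c ≠ b ∧ G.Adj a c) (hb : ∃ c, c ≠ a ∧ G.Adj b c)
    (hN : ∀ v, v ≠ a → v ≠ b → ∃ w, w ≠ a ∧ w ≠ b ∧ G.Adj v w)
    (hF : ∀ v, v ≠ a → v ≠ b → ∃ w, w ≠ a ∧ w ≠ b ∧ v ≠ w ∧ ¬ G.Adj v w) :
    ∃ f g, PrismRole G twoLoopPath f g := by
  have hc : ∀ v w, G.Adj v w → G.Adj w v := fun _ _ => SimpleGraph.Adj.symm
  have hne := hab.ne
  have hi := fun v => G.irrefl (v := v)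
  obtain ⟨c, hcb, hac⟩ := ha
  obtain ⟨d, hda, hbd⟩ := hb
  refine ⟨fun v => if v = a ∨ v = b then 0 else 1, fun v => if v = a ∨ v = b then 2 else 0,
    PrismRole.of_twoLoopPath ?_ ?_ ?_ ?_ ?_ ?_ ?_ ?_ ?_ ?_ ?_⟩
  · intro k; fin_cases k
    exacts [⟨a, by simp⟩, ⟨c, by grind⟩, ⟨a, by simp⟩]
  all_goals intro v
  · grind
  · grind
  · grind
  · grind
  · by_cases h1 : v = a
    · exact .inr ⟨b, by grind⟩
    by_cases h2 : v = b
    · exact .inr ⟨a, by grind⟩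
    exact .inl (by grind)
  · intro h
    by_cases h1 : v = a
    · exact .inr ⟨c, h1 ▸ hac, by grind⟩
    by_cases h2 : v = b
    · exact .inr ⟨d, h2 ▸ hbd, by grind⟩
    obtain ⟨w, hw⟩ := hN v h1 h2
    exact .inr ⟨w, by grind⟩
  · grind
  · by_cases h : v = a ∨ v = b
    · simp [h]
    · push Not at h
      obtain ⟨w, hw⟩ := hF v h.1 h.2
      exact .inr ⟨w, by grind⟩
  · grind
  · intro h
    by_cases h' : G.Adj v a
    · exact .inr ⟨b, by grind⟩
    · exact .inr ⟨a, by grind⟩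

-- Whether `x` is adjacent to `c` is left open: `x` is a leaf in the application to a star, and the
-- isolated vertex in the one to `K_1 ∪ K_{1,m}`.
open Classical in
theorem prismRole_of_star {V : Type*} {G : SimpleGraph V} {c x l : V} (hcx : c ≠ x)
    (hlc : l ≠ c) (hlx : l ≠ x) (hG : ∀ v w, v ≠ c → v ≠ x → (G.Adj v w ↔ w = c)) :
    ∃ f g, PrismRole G endLoopPath f g := by
  have hc : ∀ v w, G.Adj v w → G.Adj w v := fun _ _ => SimpleGraph.Adj.symm
  have hi := fun v => G.irrefl (v := v)
  obtain ⟨f, hf0, hf2, hf1⟩ : ∃ f : V → Fin 3, f c = 0 ∧ f x = 2 ∧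
      ∀ v, v ≠ c → v ≠ x → f v = 1 :=
    ⟨fun v => if v = c then 0 else if v = x then 2 else 1, by grind⟩
  obtain ⟨g, hg2, hg0, hg1⟩ : ∃ g : V → Fin 3, g c = 2 ∧ g x = 0 ∧
      ∀ v, v ≠ c → v ≠ x → g v = 1 :=
    ⟨fun v => if v = c then 2 else if v = x then 0 else 1, by grind⟩
  have cls : ∀ v, v = c ∨ v = x ∨ (v ≠ c ∧ v ≠ x ∧ f v = 1 ∧ g v = 1 ∧
      ∀ w, G.Adj v w ↔ w = c) := by grind
  refine ⟨f, g, PrismRole.of_endLoopPath ?_ ?_ ?_ ?_ ?_ ?_ ?_ ?_ ?_ ?_⟩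
  · intro k; fin_cases k
    exacts [⟨c, by grind⟩, ⟨l, by grind⟩, ⟨x, by grind⟩]
  · intro y z
    rcases cls y with rfl | rfl | ⟨_, _, _, _, _⟩ <;>
      rcases cls z with rfl | rfl | ⟨_, _, _, _, _⟩ <;>
      grind
  · intro y; rcases cls y with rfl | rfl | ⟨_, _, _, _, _⟩ <;> grind
  · intro y z
    rcases cls y with rfl | rfl | ⟨_, _, _, _, _⟩ <;>
      rcases cls z with rfl | rfl | ⟨_, _, _, _, _⟩ <;>
      grind
  all_goals intro y; rcases cls y with rfl | rfl | ⟨_, _, _, _, _⟩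
  all_goals first
    | (intro h; exfalso; revert h; simp [*]; done)
    | (intro _; left; simp [*]; done)
    | (intro _; refine .inr ⟨c, ?_⟩; grind)
    | (intro _; refine .inr ⟨x, ?_⟩; grind)
    | (intro _; refine .inr ⟨l, ?_⟩; grind)


-- The case `K_2 ∪ K_{1,m}`, with `c` the centre of the star.
open Classical in
theorem prismRole_of_edge_star {V : Type*} {G : SimpleGraph V} {u v c l : V} (huv : G.Adj u v)
    (hcu : c ≠ u) (hcv : c ≠ v) (hlc : l ≠ c) (hlu : l ≠ u) (hlv : l ≠ v)
    (hu : ∀ w, G.Adj u w ↔ w = v) (hv : ∀ w, G.Adj v w ↔ w = u)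
    (hG : ∀ w t, w ≠ u → w ≠ v → w ≠ c → (G.Adj w t ↔ t = c)) :
    ∃ f g, PrismRole G endLoopPath f g := by
  have hc : ∀ v w, G.Adj v w → G.Adj w v := fun _ _ => SimpleGraph.Adj.symm
  have hi := fun v => G.irrefl (v := v)
  obtain ⟨f, hf0, hf1⟩ : ∃ f : V → Fin 3, f c = 0 ∧ ∀ w, w ≠ c → f w = 1 :=
    ⟨fun w => if w = c then 0 else 1, by grind⟩
  obtain ⟨g, hg2, hg0, hg0', hg1⟩ : ∃ g : V → Fin 3, g c = 2 ∧ g u = 0 ∧ g v = 0 ∧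
      ∀ w, w ≠ c → w ≠ u → w ≠ v → g w = 1 :=
    ⟨fun w => if w = c then 2 else if w = u ∨ w = v then 0 else 1, by grind⟩
  have cls : ∀ w, w = u ∨ w = v ∨ w = c ∨ (w ≠ u ∧ w ≠ v ∧ w ≠ c ∧ f w = 1 ∧ g w = 1 ∧
      ∀ t, G.Adj w t ↔ t = c) := by grind
  refine ⟨f, g, PrismRole.of_endLoopPath ?_ ?_ ?_ ?_ ?_ ?_ ?_ ?_ ?_ ?_⟩
  · intro k; fin_cases k
    exacts [⟨c, by grind⟩, ⟨l, by grind⟩, ⟨c, by grind⟩]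
  · intro y z
    rcases cls y with rfl | rfl | rfl | ⟨_, _, _, _, _, _⟩ <;>
      rcases cls z with rfl | rfl | rfl | ⟨_, _, _, _, _, _⟩ <;>
      grind
  · intro y; rcases cls y with rfl | rfl | rfl | ⟨_, _, _, _, _, _⟩ <;> grind
  · intro y z
    rcases cls y with rfl | rfl | rfl | ⟨_, _, _, _, _, _⟩ <;>
      rcases cls z with rfl | rfl | rfl | ⟨_, _, _, _, _, _⟩ <;>
      grind
  all_goals intro y; rcases cls y with rfl | rfl | rfl | ⟨_, _, _, _, _, _⟩
  all_goals first
    | (intro h; exfalso; revert h; simp [*]; done)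
    | (intro _; left; simp [*]; done)
    | (intro _; refine .inr ⟨u, ?_⟩; grind)
    | (intro _; refine .inr ⟨v, ?_⟩; grind)
    | (intro _; refine .inr ⟨c, ?_⟩; grind)
    | (intro _; refine .inr ⟨l, ?_⟩; grind)


-- The case `K_{2,m}` with `m ≥ 2`, where `a` and `b` form the side of size two.
open Classical in
theorem prismRole_of_completeBipartite_two {V : Type*} {G : SimpleGraph V} {a b x l : V}
    (hab : a ≠ b) (hnab : ¬ G.Adj a b) (hxa : x ≠ a) (hxb : x ≠ b) (hla : l ≠ a) (hlb : l ≠ b)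
    (hlx : l ≠ x) (hG : ∀ w t, w ≠ a → w ≠ b → (G.Adj w t ↔ t = a ∨ t = b)) :
    ∃ f g, PrismRole G endLoopPath f g := by
  have hc : ∀ v w, G.Adj v w → G.Adj w v := fun _ _ => SimpleGraph.Adj.symm
  have hi := fun v => G.irrefl (v := v)
  obtain ⟨f, hf0, hf0', hf2, hf1⟩ : ∃ f : V → Fin 3, f a = 0 ∧ f b = 0 ∧ f x = 2 ∧
      ∀ w, w ≠ a → w ≠ b → w ≠ x → f w = 1 :=
    ⟨fun w => if w = a ∨ w = b then 0 else if w = x then 2 else 1, by grind⟩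
  obtain ⟨g, hg0, hg1⟩ : ∃ g : V → Fin 3, g x = 0 ∧ ∀ w, w ≠ x → g w = 1 :=
    ⟨fun w => if w = x then 0 else 1, by grind⟩
  have cls : ∀ w, w = a ∨ w = b ∨ w = x ∨ (w ≠ a ∧ w ≠ b ∧ w ≠ x ∧ f w = 1 ∧ g w = 1 ∧
      ∀ t, G.Adj w t ↔ t = a ∨ t = b) := by grind
  refine ⟨f, g, PrismRole.of_endLoopPath ?_ ?_ ?_ ?_ ?_ ?_ ?_ ?_ ?_ ?_⟩
  · intro k; fin_cases k
    exacts [⟨a, by grind⟩, ⟨l, by grind⟩, ⟨x, by grind⟩]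
  · intro y z
    rcases cls y with rfl | rfl | rfl | ⟨_, _, _, _, _, _⟩ <;>
      rcases cls z with rfl | rfl | rfl | ⟨_, _, _, _, _, _⟩ <;>
      grind
  · intro y; rcases cls y with rfl | rfl | rfl | ⟨_, _, _, _, _, _⟩ <;> grind
  · intro y z
    rcases cls y with rfl | rfl | rfl | ⟨_, _, _, _, _, _⟩ <;>
      rcases cls z with rfl | rfl | rfl | ⟨_, _, _, _, _, _⟩ <;>
      grind
  all_goals intro y; rcases cls y with rfl | rfl | rfl | ⟨_, _, _, _, _, _⟩
  all_goals first
    | (intro h; exfalso; revert h; simp [*]; done)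
    | (intro _; left; simp [*]; done)
    | (intro _; refine .inr ⟨a, ?_⟩; grind)
    | (intro _; refine .inr ⟨b, ?_⟩; grind)
    | (intro _; refine .inr ⟨x, ?_⟩; grind)
    | (intro _; refine .inr ⟨l, ?_⟩; grind)


-- The path on four vertices has nested neighbourhoods but is too small for the main family.
open Classical in
theorem prismRole_of_path_four {V : Type*} {G : SimpleGraph V} {a b c d : V}
    (hall : ∀ v, v = a ∨ v = b ∨ v = c ∨ v = d) (had : a ≠ d)
    (hab : G.Adj a b) (hbc : G.Adj b c) (hcd : G.Adj c d)
    (hac : ¬ G.Adj a c) (hbd : ¬ G.Adj b d) (hnad : ¬ G.Adj a d) :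
    ∃ f g, PrismRole G endLoopPath f g := by
  have hc : ∀ v w, G.Adj v w → G.Adj w v := fun _ _ => SimpleGraph.Adj.symm
  have hi := fun v => G.irrefl (v := v)
  have h1 : a ≠ b := hab.ne
  have h2 : b ≠ c := hbc.ne
  have h3 : c ≠ d := hcd.ne
  have h4 : a ≠ c := by rintro rfl; exact hnad hcd
  have h5 : b ≠ d := by rintro rfl; exact hnad hab
  obtain ⟨f, hf0, hf1⟩ : ∃ f : V → Fin 3, f a = 0 ∧ ∀ w, w ≠ a → f w = 1 :=
    ⟨fun w => if w = a then 0 else 1, by grind⟩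
  obtain ⟨g, hg2, hg1, hg0⟩ : ∃ g : V → Fin 3, g a = 2 ∧ g b = 1 ∧
      ∀ w, w ≠ a → w ≠ b → g w = 0 :=
    ⟨fun w => if w = a then 2 else if w = b then 1 else 0, by grind⟩
  have hf : f b = 1 ∧ f c = 1 ∧ f d = 1 ∧ g c = 0 ∧ g d = 0 := by grind
  obtain ⟨hfb, hfc, hfd, hgc, hgd⟩ := hf
  refine ⟨f, g, PrismRole.of_endLoopPath ?_ ?_ ?_ ?_ ?_ ?_ ?_ ?_ ?_ ?_⟩
  · intro k; fin_cases k
    exacts [⟨a, by grind⟩, ⟨b, by grind⟩, ⟨a, by grind⟩]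
  · intro y z
    rcases hall y with rfl | rfl | rfl | rfl <;>
      rcases hall z with rfl | rfl | rfl | rfl <;>
      grind
  · intro y; rcases hall y with rfl | rfl | rfl | rfl <;> grind
  · intro y z
    rcases hall y with rfl | rfl | rfl | rfl <;>
      rcases hall z with rfl | rfl | rfl | rfl <;>
      grind
  all_goals intro y; rcases hall y with rfl | rfl | rfl | rfl
  all_goals first
    | (intro h; exfalso; revert h; simp [*]; done)
    | (intro _; left; simp [*]; done)
    | (intro _; refine .inr ⟨a, ?_⟩; grind)
    | (intro _; refine .inr ⟨b, ?_⟩; grind)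
    | (intro _; refine .inr ⟨c, ?_⟩; grind)
    | (intro _; refine .inr ⟨d, ?_⟩; grind)

/-! ### Structure forced by the absence of a 3-role assignment -/

theorem not_triangle_of_isBipartite {V : Type*} {G : SimpleGraph V} (hbip : G.IsBipartite)
    {v w z : V} (h₁ : G.Adj v w) (h₂ : G.Adj v z) : ¬ G.Adj w z := by
  obtain ⟨κ⟩ := hbip
  intro h₃
  have := κ.valid h₁; have := κ.valid h₂; have := κ.valid h₃; omega

theorem PrismRole.hasRoleAssignment {V : Type*} {G : SimpleGraph V} {R : Fin 3 → Fin 3 → Prop}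
    (h : ∃ f g, PrismRole G R f g) : HasRoleAssignment (complementaryPrism G) 3 := by
  obtain ⟨f, g, h⟩ := h
  exact hasRoleAssignment_prism_iff.2 ⟨R, f, g, h⟩

/-- Neighbourhoods of non-isolated vertices are pairwise incomparable or equal. -/
def NbhdAntichain {V : Type*} (G : SimpleGraph V) : Prop :=
  ∀ a s n, G.Adj s n → (∀ t, G.Adj s t → G.Adj a t) → ∀ t, G.Adj a t → G.Adj s t

/-- Vertices with a common neighbour have the same neighbours. -/
def NbhdTwins {V : Type*} (G : SimpleGraph V) : Prop :=
  ∀ a s n t, G.Adj a n → G.Adj s n → G.Adj a t → G.Adj s t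

theorem hasRoleAssignment_of_nbhd_ssubset_of_nonadj {V : Type*} {G : SimpleGraph V}
    (hbip : G.IsBipartite) {a s n₀ n₁ m : V} (hs₀ : G.Adj s n₀)
    (hsub : ∀ t, G.Adj s t → G.Adj a t) (ha₁ : G.Adj a n₁) (hs₁ : ¬ G.Adj s n₁)
    (hma : m ≠ a) (hms : m ≠ s) (ham : ¬ G.Adj a m) :
    HasRoleAssignment (complementaryPrism G) 3 := by
  have hsa : s ≠ a := by rintro rfl; exact hs₁ ha₁
  have has : ¬ G.Adj a s := fun h =>
    not_triangle_of_isBipartite hbip h (hsub _ hs₀) hs₀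
  refine PrismRole.hasRoleAssignment (prismRole_of_not_nbhd_subset hbip (hsub _ hs₀) hs₀ ha₁ hs₁
    (fun u h h' => absurd (hsub _ h) h') fun u hu hau => ?_)
  by_cases hus : u = s
  · exact ⟨m, hma, hus ▸ hms, ham, fun h => ham (hsub _ (hus ▸ h))⟩
  · exact ⟨s, hsa, fun h => hus h.symm, has, fun h => hau (hsub _ h.symm)⟩

/-- A strict inclusion feeds the main family as soon as `a` has a non-neighbour besides `a` and `s`.
Otherwise `n₁` is a leaf at `a`, its neighbourhood is strictly inside that of `n₀`, and a third
neighbour of `a` makes the main family apply to this second pair. With no third neighbour, the graph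
is the path `n₁ a n₀ s`. -/
theorem nbhdAntichain_of_not_hasRoleAssignment {V : Type*} {G : SimpleGraph V}
    (hbip : G.IsBipartite) (h : ¬ HasRoleAssignment (complementaryPrism G) 3) :
    NbhdAntichain G := by
  intro a s n₀ hs₀ hsub n₁ ha₁
  by_contra hs₁
  apply h
  by_cases hm : ∃ m, m ≠ a ∧ m ≠ s ∧ ¬ G.Adj a m
  · obtain ⟨m, hma, hms, ham⟩ := hm
    exact hasRoleAssignment_of_nbhd_ssubset_of_nonadj hbip hs₀ hsub ha₁ hs₁ hma hms ham
  push Not at hm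
  have ha₀ := hsub _ hs₀
  have htri := @not_triangle_of_isBipartite V G hbip
  have hn₁ : ∀ t, G.Adj n₁ t → t = a := by
    intro t ht
    by_contra hta
    by_cases hts : t = s
    · subst hts; exact hs₁ ht.symm
    · exact htri ha₁ (hm t hta hts) ht
  by_cases hn : ∃ m, G.Adj a m ∧ m ≠ n₀ ∧ m ≠ n₁
  · obtain ⟨m, ham, hm₀, hm₁⟩ := hn
    exact hasRoleAssignment_of_nbhd_ssubset_of_nonadj hbip (a := n₀) (s := n₁) (m := m) ha₁.symm
      (fun t ht => hn₁ t ht ▸ ha₀.symm) hs₀.symm (fun h => hs₁ h.symm) hm₀ hm₁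
      (htri ha₀ ham)
  · push Not at hn
    refine PrismRole.hasRoleAssignment (prismRole_of_path_four (a := n₁) (b := a) (c := n₀)
      (d := s) ?_ ?_ ha₁.symm ha₀ hs₀.symm (htri ha₁ ha₀) (fun h => htri h ha₀ hs₀)
      (fun h => hs₁ h.symm))
    · intro v
      by_cases h1 : v = a
      · simp [h1]
      by_cases h2 : v = s
      · simp [h2]
      have := hn v (hm v h1 h2)
      tauto
    · rintro rfl
      exact htri ha₀ ha₁ hs₀.symm

theorem nbhdTwins_of_not_hasRoleAssignment {V : Type*} {G : SimpleGraph V}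
    (hbip : G.IsBipartite) (h : ¬ HasRoleAssignment (complementaryPrism G) 3) {i : V}
    (hi : G.IsIsolated i) : NbhdTwins G := by
  have hA := nbhdAntichain_of_not_hasRoleAssignment hbip h
  have htri := @not_triangle_of_isBipartite V G hbip
  intro a s n₀ n₁ ha₀ hs₀ ha₁
  by_contra hs₁
  apply h
  have hsa : s ≠ a := by rintro rfl; exact hs₁ ha₁
  have has : ¬ G.Adj a s := fun h => htri h ha₀ hs₀
  have hni : ∀ {v w}, G.Adj v w → v ≠ i := by
    rintro v w hvw rfl
    exact hi w hvw
  refine PrismRole.hasRoleAssignment (prismRole_of_not_nbhd_subset hbip ha₀ hs₀ ha₁ hs₁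
    (fun u hsu hau => ?_) fun u hu hau => ?_)
  · by_contra hcon
    -- Now every neighbour of `u` has its neighbourhood inside that of `s`, hence equal to it and
    -- containing `n₀`. So the neighbourhood of `u` lies inside that of `n₀`, hence equals it and
    -- contains `a`.
    push Not at hcon
    refine hau ?_
    refine (hA n₀ u s hsu.symm (fun w huw => ?_) a ha₀.symm).symm
    exact (hA s w u huw.symm (hcon w huw) n₀ hs₀).symm
  · by_cases hui : u = i
    · exact ⟨s, hsa, fun e => hni hs₀ (e.trans hui), has, hui ▸ hi s⟩
    · exact ⟨i, (hni ha₀).symm, fun e => hui e.symm, fun e => hi _ e.symm, fun e => hi _ e.symm⟩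

/-- Triangle-freeness puts every neighbourhood of a vertex other than `a` and `v` inside `{a, v}`,
and the antichain condition turns this into equality: `G` is `K_{2,m}`. -/
theorem hasRoleAssignment_of_two_side {V : Type*} {G : SimpleGraph V} (hbip : G.IsBipartite)
    (hA : NbhdAntichain G) (hiso : ∀ v, ∃ w, G.Adj v w) {a b c v : V} (hab : G.Adj a b)
    (hac : G.Adj a c) (hcb : c ≠ b) (hva : v ≠ a) (hbv : G.Adj b v)
    (hfull : ∀ w, w ≠ a → w ≠ b → v ≠ w → G.Adj v w) :
    HasRoleAssignment (complementaryPrism G) 3 := by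
  have htri := @not_triangle_of_isBipartite V G hbip
  have hnav : ¬ G.Adj a v := htri hab.symm hbv
  have hb : ∀ t, G.Adj b t ↔ t = a ∨ t = v := by
    refine fun t => ⟨fun h => ?_, ?_⟩
    · by_contra hcon
      push Not at hcon
      exact htri hbv h (hfull t hcon.1 h.ne' hcon.2.symm)
    · rintro (rfl | rfl)
      exacts [hab.symm, hbv]
  refine PrismRole.hasRoleAssignment (prismRole_of_completeBipartite_two (a := a) (b := v) (x := b)
    (l := c) hva.symm hnav hab.ne' hbv.ne hac.ne' (fun e => hnav (e ▸ hac)) hcb ?_)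
  intro w t hwa hwv
  by_cases hwb : w = b
  · rw [hwb, hb]
  have hvw := hfull w hwa hwb hwv.symm
  obtain ⟨n, hn⟩ := hiso w
  have hsub : ∀ t, G.Adj w t → G.Adj b t := by
    intro t ht
    rw [hb]
    by_contra hcon
    push Not at hcon
    refine htri hvw (hfull t hcon.1 ?_ hcon.2.symm) ht
    rintro rfl
    exact htri hvw hbv.symm ht
  rw [← hb]
  exact ⟨hsub t, hA b w n hn hsub t⟩

/-- An edge with both ends of degree at least two falls under `prismRole_of_edge`, unless deleting
it leaves an isolated vertex, which violates the antichain condition, or a universal one, which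
leads to `K_{2,m}` or to an odd cycle. -/
theorem star_of_not_hasRoleAssignment {V : Type*} {G : SimpleGraph V}
    (hbip : G.IsBipartite) (h : ¬ HasRoleAssignment (complementaryPrism G) 3)
    (hiso : ∀ v, ∃ w, G.Adj v w) {a b c d : V} (hab : G.Adj a b) (hac : G.Adj a c)
    (hbd : G.Adj b d) : c = b ∨ d = a := by
  have hA := nbhdAntichain_of_not_hasRoleAssignment hbip h
  have htri := @not_triangle_of_isBipartite V G hbip
  by_contra hcon
  push Not at hcon
  obtain ⟨hcb, hda⟩ := hcon
  apply h
  refine PrismRole.hasRoleAssignment (prismRole_of_edge hab (fun v hv => htri hv.1 hv.2 hab)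
    ⟨c, hcb, hac⟩ ⟨d, hda, hbd⟩ ?_ ?_)
  · intro v hva hvb
    by_contra hcon
    push Not at hcon
    obtain ⟨w, hw⟩ := hiso v
    by_cases hwa : w = a
    · subst hwa
      refine hda ?_
      by_contra
      have h1 : ∀ t, G.Adj v t → t = w := by
        intro t ht
        by_contra htw
        by_cases htb : t = b
        · subst htb; exact htri hw ht hab
        · exact hcon t htw htb ht
      exact hda (h1 d (hA b v w hw (fun t ht => h1 t ht ▸ hab.symm) d hbd))
    · by_cases hwb : w = b
      · subst hwb
        have h1 : ∀ t, G.Adj v t → t = w := by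
          intro t ht
          by_contra htw
          by_cases hta : t = a
          · subst hta; exact htri hw ht hab.symm
          · exact hcon t hta htw ht
        exact hcb (h1 c (hA a v w hw (fun t ht => h1 t ht ▸ hab) c hac))
      · exact hcon w hwa hwb hw
  · intro v hva hvb
    by_contra hcon
    push Not at hcon
    by_cases hvd : v = d
    · subst hvd
      exact h (hasRoleAssignment_of_two_side hbip hA hiso hab hac hcb hva hbd hcon)
    by_cases hvc : v = c
    · subst hvc
      exact h (hasRoleAssignment_of_two_side hbip hA hiso hab.symm hbd hda hvb hac
        fun w h1 h2 => hcon w h2 h1)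
    -- The closed walk `c a b d v` has length five.
    have h1 := hcon c hac.ne' hcb hvc
    have h2 := hcon d hda hbd.ne' hvd
    obtain ⟨κ⟩ := hbip
    have := κ.valid h1; have := κ.valid h2; have := κ.valid hab
    have := κ.valid hac; have := κ.valid hbd
    omega

/-! ### Nonexistence in the presence of an isolated vertex -/

theorem exists_third_color {x y : Fin 3} (hxy : x ≠ y) :
    ∃ z, z ≠ x ∧ z ≠ y ∧ ∀ c, c = x ∨ c = y ∨ c = z := by
  decide +revert

/-- If the prism of a triangle-free graph with an isolated vertex, all of whose components are
complete bipartite, has a 3-role assignment, then the other vertices form a star. -/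
theorem PrismRole.star_of_isolated {V : Type*} {G : SimpleGraph V} {R : Fin 3 → Fin 3 → Prop}
    {f g : V → Fin 3} (h : PrismRole G R f g) (htri : ∀ {v w z}, G.Adj v w → G.Adj v z → ¬ G.Adj w z)
    (htw : NbhdTwins G) {i : V} (hi : G.IsIsolated i) :
    ∃ v l, v ≠ i ∧ l ≠ i ∧ l ≠ v ∧ ∀ w, w ≠ i → w ≠ v → G.Adj v w := by
  obtain ⟨x, hx⟩ : ∃ x, f i = x := ⟨_, rfl⟩
  obtain ⟨y, hy⟩ : ∃ y, g i = y := ⟨_, rfl⟩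
  have hni : ∀ {v w}, G.Adj v w → v ≠ i := by
    rintro v w hvw rfl
    exact hi w hvw
  have Rxy : R x y := hx ▸ hy ▸ h.mid i
  have Ryx := h.symm _ _ Rxy
  -- In the prism, `i` has only its own copy as neighbour.
  have Rx : ∀ c, R x c → c = y := by
    intro c hc
    rcases h.left_ex i c (hx ▸ hc) with e | ⟨w, hw, _⟩
    · exact e.symm.trans hy
    · exact absurd hw (hi w)
  have Rx' : ∀ c, R c x → c = y := fun c hc => Rx c (h.symm _ _ hc)
  have Ryg : ∀ w, w ≠ i → R y (g w) := fun w hw => hy ▸ h.right i w hw.symm (hi w)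
  have hxy : x ≠ y := by
    intro e
    subst e
    obtain ⟨c, hc⟩ : ∃ c, c ≠ x := exists_ne x
    obtain ⟨v, hv⟩ := h.surj c
    have hg : g v = x := by
      by_cases hvi : v = i
      · rw [hvi, hy]
      · exact Rx _ (Ryg v hvi)
    have hf : f v = x := Rx' _ (hg ▸ h.mid v)
    grind
  obtain ⟨z, hzx, hzy, hall⟩ := exists_third_color hxy
  have nRxz : ¬ R x z := fun e => hzy (Rx _ e)
  have nRzx : ¬ R z x := fun e => hzy (Rx' _ e)
  have nRxx : ¬ R x x := fun e => hxy (Rx _ e)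
  have Ryz : R y z := by
    by_contra hcon
    have hg : ∀ v, g v ≠ z := by
      intro v hv
      by_cases hvi : v = i
      · exact hzy (by rw [← hv, hvi, hy])
      · exact hcon (hv ▸ Ryg v hvi)
    obtain ⟨v, hv⟩ := h.surj z
    have hv := hv.resolve_right (hg v)
    have := h.mid v
    rw [hv] at this
    rcases hall (g v) with e | e | e <;> rw [e] at this
    exacts [nRzx this, hcon (h.symm _ _ this), hg v e]
  have Rzy := h.symm _ _ Ryz
  obtain ⟨w₀, hw₀i, hw₀⟩ : ∃ w, w ≠ i ∧ g w = z := by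
    rcases h.right_ex i z (hy ▸ Ryz) with e | ⟨w, hw, _, e⟩
    · exact absurd (e.symm.trans hx) hzx
    · exact ⟨w, hw.symm, e⟩
  by_cases Ryy : R y y
  · exfalso
    by_cases Rzz : R z z
    · by_cases hgx : ∃ a, g a = x
      · obtain ⟨a, ha⟩ := hgx
        have hfa : f a = y := Rx' _ (ha ▸ h.mid a)
        obtain ⟨t₀, hat₀, ht₀⟩ := (h.left_ex a y (hfa ▸ Ryy)).resolve_left (ha ▸ hxy)
        obtain ⟨t₁, hat₁, ht₁⟩ := (h.left_ex a z (hfa ▸ Ryz)).resolve_left (ha ▸ hzx.symm)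
        rcases h.left_ex t₀ x (ht₀ ▸ Ryx) with e | ⟨s, hs, e⟩
        · by_cases hw : G.Adj a w₀
          · refine nRxz (e ▸ hw₀ ▸ h.right t₀ w₀ ?_ (htri hat₀ hw))
            rintro rfl
            exact hzx (hw₀.symm.trans e)
          · refine nRxz (ha ▸ hw₀ ▸ h.right a w₀ ?_ hw)
            rintro rfl
            exact hzx (hw₀.symm.trans ha)
        -- `s` and `a` share the neighbour `t₀`, so as twins they share `t₁`: roles `x` and `z`
        -- meet.
        · exact nRxz (e ▸ ht₁ ▸ h.left s t₁ (htw a s t₀ t₁ hat₀ hs.symm hat₁))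
      · push Not at hgx
        have key : ∀ t, f t = y → ∃ s, G.Adj t s ∧ f s = x := fun t ht =>
          (h.left_ex t x (ht ▸ Ryx)).resolve_left (hgx t)
        have key' : ∀ t, f t = y → g t = z := by
          intro t ht
          rcases hall (g t) with e | e | e
          · exact absurd e (hgx t)
          · rcases h.right_ex t x (e ▸ Ryx) with e' | ⟨w, _, _, e'⟩
            · exact absurd (e'.symm.trans ht) hxy
            · exact absurd e' (hgx w)
          · exact e
        obtain ⟨v, hv⟩ : ∃ v, f v = y := by
          rcases hall (f w₀) with e | e | e
          · exact absurd (e ▸ hw₀ ▸ h.mid w₀) nRxz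
          · exact ⟨w₀, e⟩
          · obtain ⟨t, _, ht⟩ := (h.left_ex w₀ y (e ▸ Rzy)).resolve_left (hw₀ ▸ hzy)
            exact ⟨t, ht⟩
        obtain ⟨s, hvs, hs⟩ := key v hv
        obtain ⟨v', hvv', hv'⟩ := (h.left_ex v y (hv ▸ Ryy)).resolve_left (key' v hv ▸ hzy)
        obtain ⟨s', hvs', hs'⟩ := key v' hv'
        exact nRxx (by simpa [hs, hs'] using h.left s s' (htw v' s v s' hvv'.symm hvs.symm hvs'))
    · have Rz : ∀ c, R z c → c = y := by
        intro c hc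
        rcases hall c with e | e | e
        · exact absurd (e ▸ hc) nRzx
        · exact e
        · exact absurd (e ▸ hc) Rzz
      have hf : f w₀ = y := Rz _ (hw₀ ▸ h.symm _ _ (h.mid w₀))
      obtain ⟨t, hwt, ht⟩ := (h.left_ex w₀ x (hf ▸ Ryx)).resolve_left (hw₀ ▸ hzx)
      obtain ⟨t', hwt', ht'⟩ := (h.left_ex w₀ y (hf ▸ Ryy)).resolve_left (hw₀ ▸ hzy)
      have hst : ∀ s, G.Adj t' s → G.Adj s t := fun s hs => htw w₀ s t' t hwt' hs.symm hwt
      have hg : g t' = x := by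
        refine (h.left_ex t' x (ht' ▸ Ryx)).resolve_right ?_
        rintro ⟨s, hs, e⟩
        exact nRxx (by simpa [e, ht] using h.left s t (hst s hs))
      obtain ⟨s, hs, e⟩ := (h.left_ex t' z (ht' ▸ Ryz)).resolve_left (hg ▸ hzx.symm)
      exact nRzx (e ▸ ht ▸ h.left s t (hst s hs))
  -- The copy of `i` has role `y` and is adjacent to all other copies. So role `y` occurs only there
  -- in the complement, and a further copy of role `x` has no other neighbour among the copies: its
  -- vertex is the centre sought.
  · have hgy : ∀ w, w ≠ i → g w ≠ y := fun w hw e => Ryy (e ▸ Ryg w hw)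
    by_cases Rzz : R z z
    · by_cases hgx : ∃ v, v ≠ i ∧ g v = x
      · obtain ⟨v, hvi, hv⟩ := hgx
        refine ⟨v, w₀, hvi, hw₀i, fun e => hzx (by rw [← hw₀, e, hv]), fun w hwi hwv => ?_⟩
        by_contra hcon
        exact hgy w hwi (Rx _ (hv ▸ h.right v w hwv.symm hcon))
      · exfalso
        push Not at hgx
        have hgz : ∀ w, w ≠ i → g w = z := fun w hw =>
          ((hall (g w)).resolve_left (hgx w hw)).resolve_left (hgy w hw)
        have hfz : ∀ w, w ≠ i → f w = z := by
          intro w hw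
          rcases hall (f w) with e | e | e
          · exact absurd (e ▸ hgz w hw ▸ h.mid w) nRxz
          · obtain ⟨t, ht, e'⟩ := (h.left_ex w x (e ▸ Ryx)).resolve_left (hgx w hw)
            exact absurd (e' ▸ hgz t (hni ht.symm) ▸ h.mid t) nRxz
          · exact e
        obtain ⟨t, ht, e⟩ := (h.left_ex w₀ y (hfz w₀ hw₀i ▸ Rzy)).resolve_left (hgy w₀ hw₀i)
        exact hzy ((hfz t (hni ht.symm)).symm.trans e)
    · exfalso
      have Rz : ∀ c, R z c → c = y := by
        intro c hc
        rcases hall c with e | e | e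
        · exact absurd (e ▸ hc) nRzx
        · exact e
        · exact absurd (e ▸ hc) Rzz
      have hg : ∀ w c, w ≠ i → R (g w) c → c = y := by
        intro w c hw hc
        rcases hall (g w) with e | e | e
        · exact Rx _ (e ▸ hc)
        · exact absurd e (hgy w hw)
        · exact Rz _ (e ▸ hc)
      have hf : ∀ w, w ≠ i → f w = y := fun w hw => hg w _ hw (h.symm _ _ (h.mid w))
      obtain ⟨t, ht, _⟩ := (h.left_ex w₀ x (hf w₀ hw₀i ▸ Ryx)).resolve_left (hw₀ ▸ hzx)
      exact Ryy (by simpa [hf w₀ hw₀i, hf t (hni ht.symm)] using h.left w₀ t ht)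

/-! ### Nonexistence for star forests -/

/-- Every edge has an end of degree one. -/
def StarEdges {V : Type*} (G : SimpleGraph V) : Prop :=
  ∀ {a b c d}, G.Adj a b → G.Adj a c → G.Adj b d → c = b ∨ d = a

section StarForest

variable {V : Type*} {G : SimpleGraph V} {R : Fin 3 → Fin 3 → Prop} {f g : V → Fin 3}
  {x y z : Fin 3}

/-- A leaf has only two neighbours in the prism, so it cannot see three roles. -/
theorem PrismRole.not_all_of_leaf (h : PrismRole G R f g) {e d : V}
    (hed : ∀ w, G.Adj e w → w = d) (hxy : x ≠ y) (hxz : x ≠ z) (hyz : y ≠ z)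
    (hx : R (f e) x) (hy : R (f e) y) (hz : R (f e) z) : False := by
  have key : ∀ c, R (f e) c → g e = c ∨ f d = c := by
    intro c hc
    rcases h.left_ex e c hc with h' | ⟨w, hw, h'⟩
    · exact .inl h'
    · exact .inr (hed w hw ▸ h')
  have := key x hx; have := key y hy; have := key z hz
  grind

/-- The nonadjacent roles `x` and `y` do not both occur in the complement. -/
theorem PrismRole.path_of_bar_adj (h : PrismRole G R f g) (hstar : StarEdges G)
    (hfar : ∀ a b, G.Adj a b → ∃ p q, p ≠ q ∧ ¬ G.Adj p q ∧ ¬ G.Adj a p ∧ ¬ G.Adj b p ∧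
      ¬ G.Adj a q ∧ ¬ G.Adj b q)
    (hxy : x ≠ y) (hxz : x ≠ z) (hyz : y ≠ z) (hall : ∀ c, c = x ∨ c = y ∨ c = z)
    (nRxy : ¬ R x y) (Rzx : R z x) (Rzy : R z y) {v w : V} (hv : g v = x) (hw : g w = y)
    (hvw : G.Adj v w) (hleaf : ∀ t, G.Adj w t → t = v) : False := by
  have nRyx : ¬ R y x := fun e => nRxy (h.symm _ _ e)
  -- The copy of `p` is adjacent to copies of roles `x` and `y`, and only `z` can be adjacent to
  -- both. Two such vertices that are nonadjacent force a loop at `z`, which bars role `z` from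
  -- leaves.
  have bar : ∀ p, ¬ G.Adj v p → ¬ G.Adj w p → g p = z := by
    intro p hp hp'
    have hpv : p ≠ v := by rintro rfl; exact hp' hvw.symm
    have hpw : p ≠ w := by rintro rfl; exact hp hvw
    rcases hall (g p) with e | e | e
    · exact absurd (hw ▸ e ▸ h.right w p hpw.symm hp') nRyx
    · exact absurd (hv ▸ e ▸ h.right v p hpv.symm hp) nRxy
    · exact e
  obtain ⟨p, q, hpq, hnpq, h1, h2, h3, h4⟩ := hfar v w hvw
  have Rzz : R z z := by simpa [bar p h1 h2, bar q h3 h4] using h.right p q hpq hnpq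
  have leaf : ∀ e d, (∀ t, G.Adj e t → t = d) → f e ≠ z := fun e d hed he =>
    h.not_all_of_leaf hed hxy hxz hyz (he ▸ Rzx) (he ▸ Rzy) (by rw [he]; exact Rzz)
  by_cases Rxx : R x x
  · have hfv : f v = x := by
      refine (h.right_ex v x (hv ▸ Rxx)).resolve_right ?_
      rintro ⟨t, htv, _, e⟩
      have htw : t ≠ w := by rintro rfl; exact hxy (e.symm.trans hw)
      refine nRyx (hw ▸ e ▸ h.right w t htw.symm fun hwt => ?_)
      exact htv (hleaf t hwt).symm
    rcases hall (f w) with e | e | e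
    · exact nRxy (hw ▸ e ▸ h.mid w)
    · exact nRxy (hfv ▸ e ▸ h.left v w hvw)
    · exact leaf w v hleaf e
  · have hfv : f v = z := by
      have hR := h.mid v
      rw [hv] at hR
      rcases hall (f v) with e | e | e
      · exact absurd (e ▸ hR) Rxx
      · exact absurd (e ▸ hR) nRyx
      · exact e
    have hfw : f w = y := by
      rcases hall (f w) with e | e | e
      · exact absurd (hw ▸ e ▸ h.mid w) nRxy
      · exact e
      · exact absurd e (leaf w v hleaf)
    obtain ⟨e, hve, he⟩ := (h.left_ex v z (by rw [hfv]; exact Rzz)).resolve_left (hv ▸ hxz)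
    refine leaf e v (fun d hd => ?_) he
    refine (hstar hve hvw hd).resolve_left ?_
    rintro rfl
    exact hyz (hfw.symm.trans he)

/-- Of two nonadjacent roles, `y` must occur in the complement. -/
theorem PrismRole.path_of_bar_avoids (h : PrismRole G R f g) (hstar : StarEdges G)
    (hiso : ∀ v, ∃ w, G.Adj v w)
    (hfar : ∀ a b, G.Adj a b → ∃ p, ¬ G.Adj a p ∧ ¬ G.Adj b p)
    (hxy : x ≠ y) (hxz : x ≠ z) (hyz : y ≠ z) (hall : ∀ c, c = x ∨ c = y ∨ c = z)
    (nRxy : ¬ R x y) (Rzx : R z x) (Rzy : R z y) (hg : ∀ v, g v ≠ y) : False := by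
  have nRyx : ¬ R y x := fun e => nRxy (h.symm _ _ e)
  have hgz : ∀ v, g v = z → f v = y := by
    intro v hv
    refine (h.right_ex v y (hv ▸ Rzy)).resolve_right ?_
    rintro ⟨w, _, _, e⟩
    exact hg w e
  have hfy : ∀ v, f v = y → g v = z := by
    intro v hv
    rcases hall (g v) with e | e | e
    · exact absurd (hv ▸ e ▸ h.mid v) nRyx
    · exact absurd e (hg v)
    · exact e
  have hf : ∀ v, f v ≠ y → g v = x := by
    intro v hv
    rcases hall (g v) with e | e | e
    · exact e
    · exact absurd e (hg v)
    · exact absurd (hgz v e) hv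
  by_cases Rzz : R z z
  · have leaf : ∀ e d, (∀ t, G.Adj e t → t = d) → f e ≠ z := fun e d hed he =>
      h.not_all_of_leaf hed hxy hxz hyz (he ▸ Rzx) (he ▸ Rzy) (by rw [he]; exact Rzz)
    have hfz : ∀ v, f v ≠ z := by
      intro v hv
      have hgv := hf v (hv ▸ hyz.symm)
      obtain ⟨e, hve, he⟩ := (h.left_ex v z (by rw [hv]; exact Rzz)).resolve_left (hgv ▸ hxz)
      by_cases hvl : ∀ t, G.Adj v t → t = e
      · exact leaf v e hvl hv
      · push Not at hvl
        obtain ⟨t, hvt, hte⟩ := hvl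
        exact leaf e v (fun d hd => (hstar hve hvt hd).resolve_left hte) he
    have hfx : ∀ v, f v ≠ x := by
      intro v hv
      have hgv := hf v (hv ▸ hxy)
      obtain ⟨e, _, he⟩ :=
        (h.left_ex v z (hv ▸ h.symm _ _ Rzx)).resolve_left (hgv ▸ hxz)
      exact hfz e he
    obtain ⟨v, hv⟩ := h.surj x
    have hgv := hv.resolve_left (hfx v)
    rcases hall (f v) with e | e | e
    · exact hfx v e
    · exact hxz (hgv.symm.trans (hfy v e))
    · exact hfz v e
  · obtain ⟨u, hu⟩ := h.surj y
    have hu := hu.resolve_right (hg u)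
    obtain ⟨v, huv⟩ := hiso u
    obtain ⟨p, hup, hvp⟩ := hfar u v huv
    -- Copies of vertices of role `y` all have role `z`, which has no loop, so these vertices are
    -- pairwise adjacent in `G`. In a star forest this clashes with the far vertex `p`, which needs
    -- role `y` within distance two.
    have clique : ∀ w, w ≠ u → f w = y → G.Adj w u := by
      intro w hwu hw
      by_contra hcon
      exact Rzz (by simpa [hfy w hw, hfy u hu] using h.right w u hwu hcon)
    have hpu : p ≠ u := by rintro rfl; exact hvp huv.symm
    have star : ∀ q, G.Adj p q → ¬ G.Adj q u := by
      intro q hpq hqu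
      rcases hstar hqu hpq.symm huv with e | e
      · exact hpu e
      · exact hvp (e ▸ hpq.symm)
    have hfp : f p ≠ y := fun e => hup (clique p hpu e).symm
    rcases hall (f p) with e | e | e
    · obtain ⟨q, hpq, hq⟩ :=
        (h.left_ex p z (e ▸ h.symm _ _ Rzx)).resolve_left (hf p hfp ▸ hxz)
      obtain ⟨r, hqr, hr⟩ :=
        (h.left_ex q y (hq ▸ Rzy)).resolve_left (hg q)
      have hru : r ≠ u := by
        rintro rfl
        exact star q hpq hqr
      rcases hstar hqr hpq.symm (clique r hru hr) with e' | e'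
      · exact hfp (e' ▸ hr)
      · exact hyz (by rw [← hu, e', hq])
    · exact hfp e
    · obtain ⟨q, hpq, hq⟩ := (h.left_ex p y (e ▸ Rzy)).resolve_left (hg p)
      have hqu : q ≠ u := by
        rintro rfl
        exact hup hpq.symm
      exact star q hpq (clique q hqu hq)

/-- Leaves cannot have role `z`, which sees all three roles. This forces role `z` on the copies of
centres, then, once centres are shown to avoid `z`, on the copies of leaves. With the complement
entirely of role `z`, each vertex of `G` would have to carry both `x` and `y`. -/
theorem PrismRole.triangle_of_loop (h : PrismRole G R f g) (hstar : StarEdges G)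
    (hiso : ∀ v, ∃ w, G.Adj v w) [Nonempty V]
    (hxy : x ≠ y) (hxz : x ≠ z) (hyz : y ≠ z) (hR : ∀ c d, c ≠ d → R c d) (Rzz : R z z)
    (nRxx : ¬ R x x) : False := by
  have leafz : ∀ e d, (∀ t, G.Adj e t → t = d) → f e ≠ z := by
    intro e d hed hcon
    have : ∀ c, R (f e) c := by
      intro c
      by_cases hc : z = c
      · rw [hcon, ← hc]; exact Rzz
      · rw [hcon]; exact hR _ _ hc
    exact h.not_all_of_leaf hed hxy hxz hyz (this x) (this y) (this z)
  have leaf : ∀ e d, (∀ t, G.Adj e t → t = d) → ∀ c, c ≠ f e → c ≠ f d → g e = c := by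
    intro e d hed c hce hcd
    refine (h.left_ex e c (hR _ _ hce.symm)).resolve_right ?_
    rintro ⟨w, hw, e'⟩
    exact hcd (hed w hw ▸ e'.symm)
  have leaf' : ∀ d e, G.Adj d e → (∀ t, G.Adj e t → t = d) → ∀ c, G.Adj d c →
      ∀ t, G.Adj c t → t = d := by
    intro d e hde hed c hdc t hct
    by_cases hec : e = c
    · exact hed t (hec ▸ hct)
    · exact (hstar hdc hde hct).resolve_left hec
  have centre : ∀ d e, G.Adj d e → (∀ t, G.Adj e t → t = d) → g d = z := by
    intro d e hde hed
    have : R (f d) z := by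
      by_cases hd : f d = z
      · rw [hd]; exact Rzz
      · exact hR _ _ hd
    refine (h.left_ex d z this).resolve_right ?_
    rintro ⟨c, hdc, hc⟩
    exact leafz c d (leaf' d e hde hed c hdc) hc
  have hfd : ∀ d e, G.Adj d e → (∀ t, G.Adj e t → t = d) → f d ≠ z := by
    intro d e hde hed hd
    have hgd := centre d e hde hed
    obtain ⟨e', hde', he'⟩ :=
      (h.left_ex d y (hd ▸ hR z y hyz.symm)).resolve_left (hgd ▸ hyz.symm)
    have hed' := leaf' d e hde hed e' hde'
    have hge' : g e' = x := leaf e' d hed' x (he' ▸ hxy) (hd ▸ hxz)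
    obtain ⟨t, htd, _, ht⟩ :=
      (h.right_ex d x (hgd ▸ hR z x hxz.symm)).resolve_left (hd ▸ hxz.symm)
    by_cases hte : e' = t
    · subst hte
      contradiction
    · refine nRxx ?_
      simpa [hge', ht] using h.right e' t hte fun hadj => htd (hed' t hadj).symm
  have hgl : ∀ d e, G.Adj d e → (∀ t, G.Adj e t → t = d) → g e = z := fun d e hde hed =>
    leaf e d hed z (leafz e d hed).symm (hfd d e hde hed).symm
  have hgz : ∀ v, g v = z := by
    intro v
    obtain ⟨w, hvw⟩ := hiso v
    by_cases hvl : ∀ t, G.Adj v t → t = w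
    · exact hgl w v hvw.symm hvl
    · push Not at hvl
      obtain ⟨t, hvt, htw⟩ := hvl
      exact centre v w hvw fun d hd => (hstar hvw hvt hd).resolve_left htw
  have hfv : ∀ v c, c ≠ z → f v = c := by
    intro v c hc
    refine (h.right_ex v c (hgz v ▸ hR z c hc.symm)).resolve_right ?_
    rintro ⟨w, _, _, e⟩
    exact hc (e.symm.trans (hgz w))
  obtain ⟨v⟩ := ‹Nonempty V›
  exact hxy ((hfv v x hxz).symm.trans (hfv v y hyz))

/-- The complement of `G` is connected, since the ends of an edge have a common non-neighbour; hence
the prism and the role graph are connected. -/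
theorem PrismRole.mem_of_closed (h : PrismRole G R f g)
    (hfar : ∀ a b, G.Adj a b → ∃ p, ¬ G.Adj a p ∧ ¬ G.Adj b p) {C : Fin 3 → Prop}
    (hC : ∀ a b, R a b → C a → C b) {c₀ : Fin 3} (hc₀ : C c₀) (c : Fin 3) : C c := by
  obtain ⟨v, hv⟩ : ∃ v, C (g v) := by
    obtain ⟨v, hv | hv⟩ := h.surj c₀
    · exact ⟨v, hC _ _ (h.mid v) (hv ▸ hc₀)⟩
    · exact ⟨v, hv ▸ hc₀⟩
  have hg : ∀ w, C (g w) := by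
    intro w
    by_cases hvw : v = w
    · exact hvw ▸ hv
    by_cases hadj : G.Adj v w
    · obtain ⟨p, hp, hp'⟩ := hfar v w hadj
      have h1 : v ≠ p := by rintro rfl; exact hp' hadj.symm
      have h2 : w ≠ p := by rintro rfl; exact hp hadj
      exact hC _ _ (h.symm _ _ (h.right w p h2 hp')) (hC _ _ (h.right v p h1 hp) hv)
    · exact hC _ _ (h.right v w hvw hadj) hv
  obtain ⟨w, hw | hw⟩ := h.surj c
  · exact hw ▸ hC _ _ (h.symm _ _ (h.mid w)) (hg w)
  · exact hw ▸ hg w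

theorem PrismRole.path_false (h : PrismRole G R f g) (hstar : StarEdges G)
    (hiso : ∀ v, ∃ w, G.Adj v w)
    (hfar : ∀ a b, G.Adj a b → ∃ p q, p ≠ q ∧ ¬ G.Adj p q ∧ ¬ G.Adj a p ∧ ¬ G.Adj b p ∧
      ¬ G.Adj a q ∧ ¬ G.Adj b q) (hxy : x ≠ y) (nRxy : ¬ R x y) : False := by
  have hfar' : ∀ a b, G.Adj a b → ∃ p, ¬ G.Adj a p ∧ ¬ G.Adj b p := by
    intro a b hab
    obtain ⟨p, q, _, _, h1, h2, _⟩ := hfar a b hab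
    exact ⟨p, h1, h2⟩
  obtain ⟨z, hzx, hzy, hall⟩ := exists_third_color hxy
  have nRyx : ¬ R y x := fun e => nRxy (h.symm _ _ e)
  have Rxz : R x z := by
    by_contra hcon
    refine hxy (h.mem_of_closed hfar' (C := (· = x)) ?_ rfl y).symm
    rintro a b hab rfl
    rcases hall b with e | e | e
    · exact e
    · exact absurd (e ▸ hab) nRxy
    · exact absurd (e ▸ hab) hcon
  have Ryz : R y z := by
    by_contra hcon
    refine hxy (h.mem_of_closed hfar' (C := (· = y)) ?_ rfl x)
    rintro a b hab rfl
    rcases hall b with e | e | e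
    · exact absurd (e ▸ hab) nRyx
    · exact e
    · exact absurd (e ▸ hab) hcon
  have Rzx := h.symm _ _ Rxz
  have Rzy := h.symm _ _ Ryz
  have hall' : ∀ c, c = y ∨ c = x ∨ c = z := fun c => by have := hall c; tauto
  by_cases hgy : ∀ v, g v ≠ y
  · exact h.path_of_bar_avoids hstar hiso hfar' hxy hzx.symm hzy.symm hall nRxy Rzx Rzy hgy
  by_cases hgx : ∀ v, g v ≠ x
  · exact h.path_of_bar_avoids hstar hiso hfar' hxy.symm hzy.symm hzx.symm hall' nRyx Rzy Rzx hgx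
  push Not at hgy hgx
  obtain ⟨w, hw⟩ := hgy
  obtain ⟨v, hv⟩ := hgx
  have hvw : G.Adj v w := by
    by_contra hcon
    refine nRxy (hv ▸ hw ▸ h.right v w ?_ hcon)
    rintro rfl
    exact hxy (hv.symm.trans hw)
  by_cases hleaf : ∀ t, G.Adj w t → t = v
  · exact h.path_of_bar_adj hstar hfar hxy hzx.symm hzy.symm hall nRxy Rzx Rzy hv hw hvw hleaf
  · push Not at hleaf
    obtain ⟨t, hwt, htv⟩ := hleaf
    exact h.path_of_bar_adj hstar hfar hxy.symm hzy.symm hzx.symm hall' nRyx Rzy Rzx hw hv hvw.symm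
      fun d hd => (hstar hvw.symm hwt hd).resolve_left htv

/-- The prism of a sufficiently large star forest without isolated vertices has no 3-role
assignment. -/
theorem PrismRole.false_of_starForest (h : PrismRole G R f g) (hstar : StarEdges G)
    (hiso : ∀ v, ∃ w, G.Adj v w)
    (hfar : ∀ a b, G.Adj a b → ∃ p q, p ≠ q ∧ ¬ G.Adj p q ∧ ¬ G.Adj a p ∧ ¬ G.Adj b p ∧
      ¬ G.Adj a q ∧ ¬ G.Adj b q)
    (hind : ∃ q : Fin 4 → V, Function.Injective q ∧ ∀ i j, ¬ G.Adj (q i) (q j)) : False := by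
  by_cases hR : ∀ c d, c ≠ d → R c d
  swap
  · push Not at hR
    obtain ⟨c, d, hcd, hnR⟩ := hR
    exact h.path_false hstar hiso hfar hcd hnR
  obtain ⟨q, hq, hq'⟩ := hind
  obtain ⟨a, b, hab, hb⟩ : ∃ a b, G.Adj a b ∧ ∀ t, G.Adj b t → t = a := by
    obtain ⟨w, hw⟩ := hiso (q 0)
    by_cases hl : ∀ t, G.Adj (q 0) t → t = w
    · exact ⟨w, q 0, hw.symm, hl⟩
    · push Not at hl
      obtain ⟨t, ht, htw⟩ := hl
      exact ⟨q 0, w, hw, fun d hd => (hstar hw ht hd).resolve_left htw⟩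
  have : Nonempty V := ⟨a⟩
  by_cases hloop : ∀ c, R c c
  · have : ∀ c d, R c d := by
      intro c d
      by_cases hcd : c = d
      · exact hcd ▸ hloop c
      · exact hR c d hcd
    exact h.not_all_of_leaf hb (x := 0) (y := 1) (z := 2) (by decide) (by decide) (by decide)
      (this _ _) (this _ _) (this _ _)
  push Not at hloop
  obtain ⟨x, nRxx⟩ := hloop
  by_cases hnl : ∃ z, R z z
  · obtain ⟨z, Rzz⟩ := hnl
    have hxz : x ≠ z := by rintro rfl; exact nRxx Rzz
    obtain ⟨y, hyx, hyz, _⟩ := exists_third_color hxz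
    exact h.triangle_of_loop hstar hiso hyx.symm hxz hyz hR Rzz nRxx
  -- The copies of four independent vertices form a clique, so three roles force a loop.
  · obtain ⟨i, j, hij, hgij⟩ := Fintype.exists_ne_map_eq_of_card_lt (fun i => g (q i)) (by simp)
    have hr := h.right (q i) (q j) (hq.ne hij) (hq' i j)
    rw [show g (q i) = g (q j) from hgij] at hr
    exact hnl ⟨_, hr⟩

end StarForest

/-! ### Twins, components and disjoint unions -/

/-- For an edge `ab` of the component, the neighbourhoods of `b` and `a` are the two sides: their
union is closed under adjacency. -/
theorem isomorphic_kBip_of_twins {V : Type*} [Finite V] {G : SimpleGraph V}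
    (hbip : G.IsBipartite) (htw : NbhdTwins G) {C : G.ConnectedComponent}
    (hC : C.supp.Nontrivial) :
    ∃ n m : ℕ, 1 ≤ n ∧ 1 ≤ m ∧ Isomorphic C.toSimpleGraph (KBip n m) := by
  have htri := @not_triangle_of_isBipartite V G hbip
  obtain ⟨a, ha⟩ := hC.nonempty
  obtain ⟨b, hab⟩ : ∃ b, G.Adj a b := by
    obtain ⟨c, hc, hca⟩ := hC.exists_ne a
    have hr : G.Reachable a c := SimpleGraph.ConnectedComponent.exact (ha.trans hc.symm)
    obtain ⟨p⟩ := hr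
    cases p with
    | nil => exact absurd rfl hca
    | cons h _ => exact ⟨_, h⟩
  have hAB : ∀ {v w}, G.Adj v b → G.Adj a w → G.Adj v w := fun hv hw =>
    htw a _ b _ hab hv hw
  have hstep : ∀ {v w}, G.Adj v w → (G.Adj v b → G.Adj a w) ∧ (G.Adj a v → G.Adj w b) := by
    intro v w hvw
    exact ⟨fun hv => htw v a b w hv hab hvw,
      fun hv => (htw v b a w hv.symm hab.symm hvw).symm⟩
  have hmem : ∀ v, v ∈ C.supp ↔ G.Adj v b ∨ G.Adj a v := by
    intro v
    constructor
    · intro hv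
      have hr : G.Reachable a v := SimpleGraph.ConnectedComponent.exact (ha.trans hv.symm)
      obtain ⟨p⟩ := hr
      have : ∀ {u w : V} (p : G.Walk u w), (G.Adj u b ∨ G.Adj a u) → G.Adj w b ∨ G.Adj a w := by
        intro u w p
        induction p with
        | nil => exact id
        | cons h _ ih =>
          rintro (h' | h')
          · exact ih (.inr ((hstep h).1 h'))
          · exact ih (.inl ((hstep h).2 h'))
      exact this p (.inl hab)
    · have hb : b ∈ C.supp := C.mem_supp_of_adj_mem_supp ha hab
      rintro (h | h)
      · exact C.mem_supp_of_adj_mem_supp hb h.symm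
      · exact C.mem_supp_of_adj_mem_supp ha h
  obtain ⟨n, ⟨eA⟩⟩ := Finite.exists_equiv_fin {v // G.Adj v b}
  obtain ⟨m, ⟨eB⟩⟩ := Finite.exists_equiv_fin {v // G.Adj a v}
  refine ⟨n, m, (eA ⟨a, hab⟩).pos, (eB ⟨b, hab⟩).pos, ?_⟩
  let φ : Fin n ⊕ Fin m → C := Sum.elim
    (fun k => ⟨(eA.symm k).1, (hmem _).2 (.inl (eA.symm k).2)⟩)
    (fun k => ⟨(eB.symm k).1, (hmem _).2 (.inr (eB.symm k).2)⟩)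
  have hdisj : ∀ v, G.Adj v b → ¬ G.Adj a v := fun v h h' => htri h' hab h
  have hφ : Function.Bijective φ := by
    constructor
    · rintro (k | k) (l | l) h
      · simpa [φ, Subtype.val_inj] using h
      · refine absurd (eB.symm l).2 (hdisj _ ?_)
        have := congrArg Subtype.val h
        simp only [φ, Sum.elim_inl, Sum.elim_inr] at this
        exact this ▸ (eA.symm k).2
      · refine absurd (eB.symm k).2 (hdisj _ ?_)
        have := congrArg Subtype.val h
        simp only [φ, Sum.elim_inl, Sum.elim_inr] at this
        exact this ▸ (eA.symm l).2
      · simpa [φ, Subtype.val_inj] using h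
    · rintro ⟨v, hv⟩
      rcases (hmem v).1 hv with h | h
      · exact ⟨.inl (eA ⟨v, h⟩), by simp [φ]⟩
      · exact ⟨.inr (eB ⟨v, h⟩), by simp [φ]⟩
  refine ⟨(SimpleGraph.Iso.symm ⟨Equiv.ofBijective φ hφ, ?_⟩)⟩
  rintro (k | k) (l | l)
  · simp only [φ, Equiv.ofBijective_apply, Sum.elim_inl]
    simp [SimpleGraph.ConnectedComponent.toSimpleGraph]
    exact htri (eA.symm k).2.symm (eA.symm l).2.symm
  · simp [φ, SimpleGraph.ConnectedComponent.toSimpleGraph]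
    exact hAB (eA.symm k).2 (eB.symm l).2
  · simp [φ, SimpleGraph.ConnectedComponent.toSimpleGraph]
    exact (hAB (eA.symm l).2 (eB.symm k).2).symm
  · simp [φ, SimpleGraph.ConnectedComponent.toSimpleGraph]
    exact htri (eB.symm k).2 (eB.symm l).2

theorem nbhdTwins_of_isomorphic_kBip {V : Type*} {G : SimpleGraph V}
    (hG : ∀ C : G.ConnectedComponent, C.supp.Nontrivial →
      ∃ n m : ℕ, 1 ≤ n ∧ 1 ≤ m ∧ Isomorphic C.toSimpleGraph (KBip n m)) : NbhdTwins G := by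
  intro a s n t han hsn hat
  let C := G.connectedComponentMk a
  have ha : a ∈ C.supp := rfl
  have hn : n ∈ C.supp := C.mem_supp_of_adj_mem_supp ha han
  have hs : s ∈ C.supp := C.mem_supp_of_adj_mem_supp hn hsn.symm
  have ht : t ∈ C.supp := C.mem_supp_of_adj_mem_supp ha hat
  obtain ⟨k, l, _, _, ⟨e⟩⟩ := hG C ⟨a, ha, n, hn, han.ne⟩
  have key : ∀ (v w : C.supp), G.Adj v w ↔ (KBip k l).Adj (e v) (e w) := fun v w =>
    (e.map_adj_iff (v := v) (w := w)).symm
  have h1 := (key ⟨a, ha⟩ ⟨n, hn⟩).1 han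
  have h2 := (key ⟨s, hs⟩ ⟨n, hn⟩).1 hsn
  have h3 := (key ⟨a, ha⟩ ⟨t, ht⟩).1 hat
  refine (key ⟨s, hs⟩ ⟨t, ht⟩).2 ?_
  revert h1 h2 h3
  generalize e ⟨a, ha⟩ = x
  generalize e ⟨s, hs⟩ = y
  generalize e ⟨n, hn⟩ = z
  generalize e ⟨t, ht⟩ = w
  rcases x with x | x <;> rcases y with y | y <;> rcases z with z | z <;> rcases w with w | w <;>
    simp

/-- A graph is the disjoint union of its connected components. -/
def isoDisjointUnion {V : Type*} (G : SimpleGraph V) :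
    disjointUnion (fun C : G.ConnectedComponent => C.toSimpleGraph) ≃g G where
  toFun x := x.2.1
  invFun v := ⟨G.connectedComponentMk v, v, rfl⟩
  left_inv := by
    rintro ⟨C, v, rfl⟩
    rfl
  right_inv v := rfl
  map_rel_iff' := by
    rintro ⟨C, v, rfl⟩ ⟨D, w, rfl⟩
    constructor
    · intro h
      have hw : w ∈ (G.connectedComponentMk v).supp :=
        (G.connectedComponentMk v).mem_supp_of_adj_mem_supp rfl h
      refine ⟨_, ⟨v, rfl⟩, ⟨w, hw⟩, h, rfl, ?_⟩
      have key : ∀ (C D : G.ConnectedComponent) (hC : w ∈ C.supp) (hD : w ∈ D.supp),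
          (⟨C, w, hC⟩ : Σ C : G.ConnectedComponent, C) = ⟨D, w, hD⟩ := by
        rintro _ _ rfl rfl
        rfl
      exact key _ _ _ _
    · rintro ⟨E, a, b, h, h1, h2⟩
      have hv : v = a.1 := congrArg (fun x : Σ C : G.ConnectedComponent, C => x.2.1) h1
      have hw : w = b.1 := congrArg (fun x : Σ C : G.ConnectedComponent, C => x.2.1) h2
      show G.Adj v w
      rw [hv, hw]
      exact h

/-- Disjoint unions of isomorphic graphs are isomorphic. -/
def disjointUnionCongr {ι ι' : Type*} {V : ι → Type*} {V' : ι' → Type*}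
    {G : ∀ i, SimpleGraph (V i)} {H : ∀ i, SimpleGraph (V' i)} (e : ι ≃ ι')
    (φ : ∀ i, G i ≃g H (e i)) : disjointUnion G ≃g disjointUnion H where
  toEquiv := Equiv.sigmaCongr e fun i => (φ i).toEquiv
  map_rel_iff' := by
    rintro ⟨i, a⟩ ⟨j, b⟩
    constructor
    · rintro ⟨k, c, d, h, h1, h2⟩
      obtain ⟨k, rfl⟩ := e.surjective k
      have hi : e i = e k := congrArg Sigma.fst h1
      have hj : e j = e k := congrArg Sigma.fst h2
      obtain rfl := e.injective hi
      obtain rfl := e.injective hj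
      have h1 : φ j a = c := by simpa [Equiv.sigmaCongr] using h1
      have h2 : φ j b = d := by simpa [Equiv.sigmaCongr] using h2
      subst h1 h2
      exact ⟨j, a, b, (φ j).map_adj_iff.1 h, rfl, rfl⟩
    · rintro ⟨k, c, d, h, h1, h2⟩
      cases h1
      cases h2
      exact ⟨_, _, _, (φ _).map_adj_iff.2 h, rfl, rfl⟩

theorem exists_iso_disjointUnion_kBip {V : Type*} [Finite V] {G : SimpleGraph V}
    (hbip : G.IsBipartite) (hstar : StarEdges G) (hiso : ∀ v, ∃ w, G.Adj v w) :
    ∃ (t : ℕ) (m : Fin t → ℕ), (∀ i, 1 ≤ m i) ∧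
      Isomorphic G (disjointUnion fun i : Fin t => KBip 1 (m i)) := by
  have htw : NbhdTwins G := by
    intro a s n t han hsn hat
    rcases hstar han.symm hsn.symm hat with rfl | rfl
    exacts [hat, hsn]
  have key : ∀ C : G.ConnectedComponent, ∃ m : ℕ, 1 ≤ m ∧ Isomorphic C.toSimpleGraph (KBip 1 m) := by
    intro C
    obtain ⟨v, rfl⟩ := C.exists_rep
    obtain ⟨w, hvw⟩ := hiso v
    have hC : (G.connectedComponentMk v).supp.Nontrivial :=
      ⟨v, rfl, w, SimpleGraph.ConnectedComponent.mem_supp_of_adj_mem_supp _ rfl hvw, hvw.ne⟩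
    obtain ⟨n, m, hn, hm, ⟨e⟩⟩ := isomorphic_kBip_of_twins hbip htw hC
    by_cases hn1 : n = 1
    · subst hn1
      exact ⟨m, hm, ⟨e⟩⟩
    by_cases hm1 : m = 1
    · subst hm1
      refine ⟨n, hn, ⟨e.trans ⟨Equiv.sumComm _ _, ?_⟩⟩⟩
      rintro (x | x) (y | y) <;> simp
    -- With both sides of size at least two, every edge has two ends of degree at least two.
    · exfalso
      have adj : ∀ x y, (KBip n m).Adj x y → G.Adj (e.symm x).1 (e.symm y).1 := fun x y h =>
        e.symm.map_adj_iff.2 h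
      have inj : ∀ {x y}, (e.symm x).1 = (e.symm y).1 → x = y := fun h =>
        e.symm.injective (Subtype.ext h)
      have h1 := adj (.inl ⟨0, by omega⟩) (.inr ⟨0, by omega⟩) (by simp)
      have h2 := adj (.inl ⟨0, by omega⟩) (.inr ⟨1, by omega⟩) (by simp)
      have h3 := adj (.inr ⟨0, by omega⟩) (.inl ⟨1, by omega⟩) (by simp)
      rcases hstar h1 h2 h3 with h | h
      · simpa using inj h
      · simpa using inj h
  choose m hm hφ using key
  obtain ⟨t, ⟨e⟩⟩ := Finite.exists_equiv_fin G.ConnectedComponent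
  refine ⟨t, m ∘ e.symm, fun i => hm _, ⟨(isoDisjointUnion G).symm.trans
    (SimpleGraph.Iso.symm (disjointUnionCongr e.symm fun i => (hφ (e.symm i)).some.symm))⟩⟩

theorem disjointUnion_kBip_adj {ι : Type*} {m : ι → ℕ} {x y : Σ i, Fin 1 ⊕ Fin (m i)} :
    (disjointUnion fun i => KBip 1 (m i)).Adj x y ↔ x.1 = y.1 ∧ x.2.isLeft ≠ y.2.isLeft := by
  have key : ∀ {k} (c d : Fin 1 ⊕ Fin k), (KBip 1 k).Adj c d ↔ c.isLeft ≠ d.isLeft := by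
    rintro k (c | c) (d | d) <;> simp
  obtain ⟨i, a⟩ := x
  obtain ⟨j, b⟩ := y
  constructor
  · rintro ⟨k, c, d, h, h1, h2⟩
    cases h1
    cases h2
    exact ⟨rfl, (key _ _).1 h⟩
  · rintro ⟨h, h'⟩
    obtain rfl : i = j := h
    exact ⟨i, a, b, (key _ _).2 h', rfl, rfl⟩

theorem starEdges_disjointUnion_kBip {ι : Type*} {m : ι → ℕ} :
    StarEdges (disjointUnion fun i => KBip 1 (m i)) := by
  rintro ⟨i, a⟩ ⟨j, b⟩ ⟨k, c⟩ ⟨l, d⟩ h1 h2 h3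
  rw [disjointUnion_kBip_adj] at h1 h2 h3
  obtain ⟨rfl, h1⟩ : i = j ∧ _ := h1
  obtain ⟨rfl, h2⟩ : i = k ∧ _ := h2
  obtain ⟨rfl, h3⟩ : i = l ∧ _ := h3
  rcases a with a | a <;> rcases b with b | b <;> rcases c with c | c <;> rcases d with d | d <;>
    simp [Subsingleton.elim _ (0 : Fin 1)] at h1 h2 h3 ⊢

/-- Leaves supply both conditions of the star forest argument: two leaves outside each star, and
four leaves in all. -/
theorem not_hasRoleAssignment_disjointUnion_kBip {t : ℕ} {m : Fin t → ℕ} (hm : ∀ i, 1 ≤ m i)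
    (hfar : ∀ i, 2 ≤ ∑ j ∈ Finset.univ.erase i, m j) (hind : 4 ≤ ∑ i, m i) :
    ¬ HasRoleAssignment (complementaryPrism (disjointUnion fun i => KBip 1 (m i))) 3 := by
  intro h
  obtain ⟨R, f, g, h⟩ := hasRoleAssignment_prism_iff.1 h
  have inj : ∀ x y : Σ i, Fin (m i),
      (⟨x.1, .inr x.2⟩ : Σ i, Fin 1 ⊕ Fin (m i)) = ⟨y.1, .inr y.2⟩ → x = y := by
    rintro ⟨i, p⟩ ⟨j, q⟩ e
    cases e
    rfl
  refine h.false_of_starForest starEdges_disjointUnion_kBip ?_ ?_ ?_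
  · rintro ⟨i, a | a⟩
    · exact ⟨⟨i, .inr ⟨0, hm i⟩⟩, by simp [disjointUnion_kBip_adj]⟩
    · exact ⟨⟨i, .inl 0⟩, by simp [disjointUnion_kBip_adj]⟩
  · rintro a b hab
    have hab' := (disjointUnion_kBip_adj.1 hab).1
    have hcard : 1 < ((Finset.univ.erase a.1).sigma fun j => (Finset.univ : Finset (Fin (m j)))).card := by
      simp only [Finset.card_sigma, Finset.card_univ, Fintype.card_fin]
      exact hfar a.1
    obtain ⟨⟨i, p⟩, hp, ⟨j, q⟩, hq, hpq⟩ := Finset.one_lt_card.1 hcard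
    simp only [Finset.mem_sigma, Finset.mem_erase, Finset.mem_univ, and_true, ne_eq] at hp hq
    refine ⟨⟨i, .inr p⟩, ⟨j, .inr q⟩, ?_, ?_⟩
    · exact fun e => hpq (inj ⟨i, p⟩ ⟨j, q⟩ e)
    · simp only [disjointUnion_kBip_adj]
      refine ⟨by simp, ?_, ?_, ?_, ?_⟩ <;> rintro ⟨e, _⟩
      exacts [hp e.symm, hp (hab'.trans e).symm, hq e.symm, hq (hab'.trans e).symm]
  · have hcard : Fintype.card (Fin 4) ≤ Fintype.card (Σ i, Fin (m i)) := by simpa using hind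
    obtain ⟨q⟩ := Function.Embedding.nonempty_of_card_le hcard
    refine ⟨fun k => ⟨(q k).1, .inr (q k).2⟩, ?_, ?_⟩
    · exact fun k l hkl => q.injective (inj _ _ hkl)
    · simp [disjointUnion_kBip_adj]

/-! ### The individual graphs of the classification -/

theorem not_hasRoleAssignment_K_two : ¬ HasRoleAssignment (complementaryPrism (K 2)) 3 := by
  intro h
  obtain ⟨R, f, g, h⟩ := hasRoleAssignment_prism_iff.1 h
  have hadj : (K 2).Adj 0 1 := by simp
  have key : ∀ v w : Fin 2, v ≠ w → ∀ c, (R (g v) c → f v = c) ∧ (R (f v) c → g v = c ∨ f w = c) := by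
    intro v w hvw c
    constructor
    · intro hc
      refine (h.right_ex v c hc).resolve_right ?_
      rintro ⟨u, hu, hu', _⟩
      exact hu' (by simpa using hu)
    · intro hc
      rcases h.left_ex v c hc with e | ⟨u, hu, e⟩
      · exact .inl e
      · have : u = w := by
          have : v ≠ u := by simpa using hu
          omega
        exact .inr (this ▸ e)
  have h0 := key 0 1 (by decide)
  have h1 := key 1 0 (by decide)
  have m0 := h.mid 0
  have m1 := h.mid 1
  have m := h.left 0 1 hadj
  have hs := h.symm
  have hsurj : ∀ c, f 0 = c ∨ g 0 = c ∨ f 1 = c ∨ g 1 = c := by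
    intro c
    obtain ⟨v, hv⟩ := h.surj c
    have : v = 0 ∨ v = 1 := by omega
    rcases this with rfl | rfl <;> tauto
  clear key hadj h
  generalize f 0 = a at *
  generalize g 0 = b at *
  generalize f 1 = c at *
  generalize g 1 = d at *
  have s0 := hsurj 0
  have s1 := hsurj 1
  have s2 := hsurj 2
  have e : a = b ∨ a = c ∨ a = d ∨ b = c ∨ b = d ∨ c = d := by omega
  have m0' := hs _ _ m0
  have m1' := hs _ _ m1
  have m' := hs _ _ m
  have F : ∀ x y z : Fin 3, (0 = x ∨ 0 = y) → (1 = x ∨ 1 = y) → (2 = x ∨ 2 = y) → False := by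
    decide
  rcases e with rfl | rfl | rfl | rfl | rfl | rfl
  all_goals grind

/-- The role graph is the loopless triangle. The ends of edge `i` get `i` and `i + 2`, and both
their copies get the remaining role `i + 1`. -/
theorem hasRoleAssignment_three_K_two :
    HasRoleAssignment (complementaryPrism (disjointUnion fun _ : Fin 3 => KBip 1 1)) 3 := by
  refine hasRoleAssignment_prism_iff.2 ⟨(· ≠ ·), fun x => if x.2.isLeft then x.1 else x.1 + 2,
    fun x => x.1 + 1, fun _ _ => Ne.symm, ?_, ?_, ?_, ?_, ?_, ?_⟩
  · exact fun c => ⟨⟨c, .inl 0⟩, .inl (by simp)⟩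
  · rintro ⟨i, v | v⟩ ⟨j, w | w⟩ h <;> simp [disjointUnion_kBip_adj] at h ⊢ <;> omega
  · rintro ⟨i, v | v⟩ <;> simp
  · rintro ⟨i, v⟩ ⟨j, w⟩ hne h
    simp only [ne_eq, add_left_inj]
    rintro rfl
    rw [disjointUnion_kBip_adj] at h
    rcases v with v | v <;> rcases w with w | w <;>
      simp [Subsingleton.elim _ (0 : Fin 1)] at h hne
  · rintro ⟨i, v | v⟩ c hc
    · by_cases h : i + 1 = c
      · exact .inl h
      · refine .inr ⟨⟨i, .inr 0⟩, by simp [disjointUnion_kBip_adj], ?_⟩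
        simp at hc ⊢; omega
    · by_cases h : i + 1 = c
      · exact .inl h
      · refine .inr ⟨⟨i, .inl 0⟩, by simp [disjointUnion_kBip_adj], ?_⟩
        simp at hc ⊢; omega
  · rintro ⟨i, v⟩ c hc
    refine .inr ⟨⟨c - 1, .inl 0⟩, ?_, ?_, by simp⟩
    · intro h
      have : i = c - 1 := congrArg Sigma.fst h
      simp [this] at hc
    · rw [disjointUnion_kBip_adj]
      rintro ⟨h, _⟩
      have : i = c - 1 := h
      simp [this] at hc

theorem hasRoleAssignment_K_one_sum_star {m : ℕ} (hm : 1 ≤ m) :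
    HasRoleAssignment (complementaryPrism (K 1 ⊕g KBip 1 m)) 3 := by
  refine PrismRole.hasRoleAssignment (prismRole_of_star (c := .inr (.inl 0)) (x := .inl 0)
    (l := .inr (.inr ⟨0, hm⟩)) (by simp) (by simp) (by simp) ?_)
  rintro (v | v | v) (w | w | w) h1 h2 <;>
    simp_all [Subsingleton.elim _ (0 : Fin 1)]

/-- The prism of a star with at least two leaves has a 3-role assignment. -/
theorem hasRoleAssignment_star {m : Fin 1 → ℕ} (hm : 2 ≤ m 0) :
    HasRoleAssignment (complementaryPrism (disjointUnion fun i : Fin 1 => KBip 1 (m i))) 3 := by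
  refine PrismRole.hasRoleAssignment (prismRole_of_star (c := ⟨0, .inl 0⟩) (x := ⟨0, .inr ⟨0, by omega⟩⟩)
    (l := ⟨0, .inr ⟨1, by omega⟩⟩) (by simp) (by simp) (by simp) ?_)
  rintro ⟨i, v | v⟩ ⟨j, w | w⟩ h1 h2 <;> 
    obtain rfl := Subsingleton.elim i 0 <;> obtain rfl := Subsingleton.elim j 0 <;>
    simp_all [disjointUnion_kBip_adj, Subsingleton.elim _ (0 : Fin 1)]

theorem hasRoleAssignment_K_two_sum_star {m : Fin 2 → ℕ} {i j : Fin 2} (hij : i ≠ j)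
    (hi : m i = 1) (hj : 1 ≤ m j) :
    HasRoleAssignment (complementaryPrism (disjointUnion fun i : Fin 2 => KBip 1 (m i))) 3 := by
  have h0 : ∀ v : Fin (m i), v = ⟨0, by omega⟩ := fun v => by ext; simp; omega
  refine PrismRole.hasRoleAssignment (prismRole_of_edge_star (u := ⟨i, .inl 0⟩)
    (v := ⟨i, .inr ⟨0, by omega⟩⟩) (c := ⟨j, .inl 0⟩) (l := ⟨j, .inr ⟨0, hj⟩⟩) ?_ ?_ ?_ ?_ ?_ ?_ ?_ ?_ ?_)
  · simp [disjointUnion_kBip_adj]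
  · simp [hij.symm]
  · simp [hij.symm]
  · simp
  · simp [hij.symm]
  · simp [hij.symm]
  · rintro ⟨k, w | w⟩
    · simp [disjointUnion_kBip_adj]
      rintro rfl
      simp
    · constructor
      · intro h
        obtain rfl : i = k := (disjointUnion_kBip_adj.1 h).1
        simpa using h0 w
      · intro h
        rw [h]
        simp [disjointUnion_kBip_adj]
  · rintro ⟨k, w | w⟩
    · constructor
      · intro h
        obtain rfl : i = k := (disjointUnion_kBip_adj.1 h).1
        simpa using Subsingleton.elim _ _
      · intro h
        rw [h]
        simp [disjointUnion_kBip_adj]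
    · simp [disjointUnion_kBip_adj]
      rintro rfl
      simp
  · rintro ⟨k, w⟩ ⟨l, t⟩ h1 h2 h3
    have hkj : k = j := by
      by_contra hkj
      obtain rfl : i = k := by omega
      rcases w with w | w
      · exact h1 (by simpa using Subsingleton.elim _ _)
      · exact h2 (by simpa using h0 w)
    subst hkj
    rcases w with w | w
    · exact absurd (by simpa using Subsingleton.elim _ _) h3
    · constructor
      · intro h
        obtain ⟨h, h'⟩ := disjointUnion_kBip_adj.1 h
        obtain rfl : k = l := h
        rcases t with t | t
        · simpa using Subsingleton.elim _ _
        · simp at h'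
      · intro h
        rw [h]
        simp [disjointUnion_kBip_adj]

theorem isomorphic_K_one_sum_star {V : Type*} [Finite V] {G : SimpleGraph V}
    (htri : ∀ {v w z}, G.Adj v w → G.Adj v z → ¬ G.Adj w z) {i v l : V} (hi : G.IsIsolated i)
    (hvi : v ≠ i) (hli : l ≠ i) (hlv : l ≠ v) (hv : ∀ w, w ≠ i → w ≠ v → G.Adj v w) :
    ∃ m : ℕ, 1 ≤ m ∧ Isomorphic G (K 1 ⊕g KBip 1 m) := by
  obtain ⟨m, ⟨e⟩⟩ := Finite.exists_equiv_fin {w // w ≠ i ∧ w ≠ v}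
  refine ⟨m, (e ⟨l, hli, hlv⟩).pos, ?_⟩
  let φ : Fin 1 ⊕ (Fin 1 ⊕ Fin m) → V :=
    Sum.elim (fun _ => i) (Sum.elim (fun _ => v) fun k => (e.symm k).1)
  have h1 : ∀ k, (e.symm k).1 ≠ i := fun k => (e.symm k).2.1
  have h2 : ∀ k, (e.symm k).1 ≠ v := fun k => (e.symm k).2.2
  have hadj : ∀ k, G.Adj v (e.symm k).1 := fun k => hv _ (h1 k) (h2 k)
  have hφ : Function.Bijective φ := by
    constructor
    · rintro (a | a | a) (b | b | b) h
      · simpa using Subsingleton.elim _ _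
      · exact absurd h hvi.symm
      · exact absurd h (h1 b).symm
      · exact absurd h hvi
      · simpa using Subsingleton.elim _ _
      · exact absurd h (h2 b).symm
      · exact absurd h (h1 a)
      · exact absurd h (h2 a)
      · simpa [φ, Subtype.val_inj] using h
    · intro w
      by_cases hwi : w = i
      · exact ⟨.inl 0, hwi.symm⟩
      by_cases hwv : w = v
      · exact ⟨.inr (.inl 0), hwv.symm⟩
      · exact ⟨.inr (.inr (e ⟨w, hwi, hwv⟩)), by simp [φ]⟩
  refine ⟨SimpleGraph.Iso.symm ⟨Equiv.ofBijective φ hφ, ?_⟩⟩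
  have hi' : ∀ w, ¬ G.Adj w i := fun w h => hi w h.symm
  rintro (a | a | a) (b | b | b)
  · simp [φ, Subsingleton.elim a b]
  · simpa [φ] using hi _
  · simpa [φ] using hi _
  · simpa [φ] using hi' _
  · simp [φ]
  · simpa [φ] using hadj b
  · simpa [φ] using hi' _
  · simpa [φ] using (hadj a).symm
  · simpa [φ] using htri (hadj a) (hadj b)

/-- `K_{1,1}` is `K_2`. -/
def isoKBipOneOne : KBip 1 1 ≃g K 2 where
  toEquiv := finSumFinEquiv
  map_rel_iff' := by
    rintro (a | a) (b | b) <;> simp [Subsingleton.elim _ (0 : Fin 1)]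

theorem isomorphic_disjointUnion_one {m : Fin 1 → ℕ} :
    Isomorphic (disjointUnion fun i : Fin 1 => KBip 1 (m i)) (KBip 1 (m 0)) := by
  refine ⟨SimpleGraph.Iso.symm ⟨Equiv.ofBijective
    (fun a => (⟨0, a⟩ : Σ i : Fin 1, Fin 1 ⊕ Fin (m i))) ⟨?_, ?_⟩, ?_⟩⟩
  · intro a b h
    simpa using h
  · rintro ⟨i, a⟩
    obtain rfl := Subsingleton.elim i 0
    exact ⟨a, rfl⟩
  · intro a b
    change (disjointUnion fun i : Fin 1 => KBip 1 (m i)).Adj ⟨0, a⟩ ⟨0, b⟩ ↔ _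
    rcases a with a | a <;> rcases b with b | b <;> simp [disjointUnion_kBip_adj]

theorem isomorphic_disjointUnion_two {m : Fin 2 → ℕ} :
    Isomorphic (disjointUnion fun i : Fin 2 => KBip 1 (m i))
      (KBip 1 (m 0) ⊕g KBip 1 (m 1)) := by
  refine ⟨SimpleGraph.Iso.symm ⟨Equiv.ofBijective
    (Sum.elim (fun a => (⟨0, a⟩ : Σ i : Fin 2, Fin 1 ⊕ Fin (m i))) fun a => ⟨1, a⟩)
    ⟨?_, ?_⟩, ?_⟩⟩
  · rintro (a | a) (b | b) h <;> simp at h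
    · rw [h]
    · rw [h]
  · rintro ⟨i, a⟩
    obtain rfl | rfl : i = 0 ∨ i = 1 := by omega
    exacts [⟨.inl a, rfl⟩, ⟨.inr a, rfl⟩]
  · intro a b
    change (disjointUnion fun i : Fin 2 => KBip 1 (m i)).Adj
      (Sum.elim (fun a => ⟨0, a⟩) (fun a => ⟨1, a⟩) a)
      (Sum.elim (fun a => ⟨0, a⟩) (fun a => ⟨1, a⟩) b) ↔ _
    rcases a with (a | a) | (a | a) <;> rcases b with (b | b) | (b | b) <;>
      simp [disjointUnion_kBip_adj]

/-! ### Assembly of the two directions -/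

theorem hasRoleAssignment_of_not_excluded {V : Type*} [Finite V] [Nonempty V] {G : SimpleGraph V}
    (hG : G.IsBipartite) (hK2 : ¬ Isomorphic G (K 2)) (hcb : ¬ IsolatedCompleteBipartite G)
    (hK2t : ¬ ∃ t : ℕ, 4 ≤ t ∧ Isomorphic G (disjointUnion fun _ : Fin t => K 2))
    (hst : ¬ ∃ (t : ℕ) (m : Fin t → ℕ), 3 ≤ t ∧ (∀ i, 1 ≤ m i) ∧ (∃ i, 2 ≤ m i) ∧
      Isomorphic G (disjointUnion fun i : Fin t => KBip 1 (m i)))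
    (hst2 : ¬ ∃ m₁ m₂ : ℕ, 2 ≤ m₁ ∧ 2 ≤ m₂ ∧ Isomorphic G (KBip 1 m₁ ⊕g KBip 1 m₂)) :
    HasRoleAssignment (complementaryPrism G) 3 := by
  by_contra h
  by_cases hiso : ∃ i, G.IsIsolated i
  · obtain ⟨i, hi⟩ := hiso
    have htw := nbhdTwins_of_not_hasRoleAssignment hG h hi
    refine hcb ⟨⟨i, hi⟩, fun C hC => isomorphic_kBip_of_twins hG htw hC, ?_⟩
    rintro ⟨m, hm, ⟨e⟩⟩
    exact h (hasRoleAssignment_prism_of_iso e.symm (hasRoleAssignment_K_one_sum_star hm))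
  · have hiso : ∀ v, ∃ w, G.Adj v w := by
      simpa [SimpleGraph.IsIsolated] using hiso
    obtain ⟨t, m, hm, ⟨e⟩⟩ := exists_iso_disjointUnion_kBip hG
      (fun h1 h2 h3 => star_of_not_hasRoleAssignment hG h hiso h1 h2 h3) hiso
    have hD := fun h' => h (hasRoleAssignment_prism_of_iso e.symm h')
    obtain ht | rfl | rfl | ht : t = 0 ∨ t = 1 ∨ t = 2 ∨ 3 ≤ t := by omega
    · obtain ⟨v⟩ := ‹Nonempty V›
      have := (e v).1.pos
      omega
    · by_cases hm0 : 2 ≤ m 0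
      · exact hD (hasRoleAssignment_star hm0)
      · refine hK2 ⟨e.trans (isomorphic_disjointUnion_one.some.trans ?_)⟩
        have : m 0 = 1 := by have := hm 0; omega
        rw [this]
        exact isoKBipOneOne
    · by_cases h0 : m 0 = 1
      · exact hD (hasRoleAssignment_K_two_sum_star (i := 0) (j := 1) (by decide) h0 (hm 1))
      by_cases h1 : m 1 = 1
      · exact hD (hasRoleAssignment_K_two_sum_star (i := 1) (j := 0) (by decide) h1 (hm 0))
      have := hm 0
      have := hm 1
      exact hst2 ⟨m 0, m 1, by omega, by omega, ⟨e.trans isomorphic_disjointUnion_two.some⟩⟩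
    · by_cases h2 : ∃ i, 2 ≤ m i
      · exact hst ⟨t, m, ht, hm, h2, ⟨e⟩⟩
      · obtain rfl : m = fun _ => 1 := by
          funext i
          have := hm i
          by_contra hi
          exact h2 ⟨i, by omega⟩
        by_cases ht3 : t = 3
        · subst ht3
          exact hD hasRoleAssignment_three_K_two
        · exact hK2t ⟨t, by omega,
            ⟨e.trans (disjointUnionCongr (Equiv.refl _) fun _ => isoKBipOneOne)⟩⟩

theorem exists_star_of_isolated {V : Type*} {G : SimpleGraph V} (hG : G.IsBipartite)
    (h : HasRoleAssignment (complementaryPrism G) 3) (htw : NbhdTwins G) {i : V}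
    (hi : G.IsIsolated i) :
    ∃ v l, v ≠ i ∧ l ≠ i ∧ l ≠ v ∧ ∀ w, w ≠ i → w ≠ v → G.Adj v w := by
  obtain ⟨R, f, g, h⟩ := hasRoleAssignment_prism_iff.1 h
  exact h.star_of_isolated (@not_triangle_of_isBipartite V G hG) htw hi

theorem not_hasRoleAssignment_stars {t : ℕ} {m : Fin t → ℕ} (ht : 3 ≤ t) (hm : ∀ i, 1 ≤ m i)
    (h4 : 4 ≤ t ∨ ∃ i, 2 ≤ m i) :
    ¬ HasRoleAssignment (complementaryPrism (disjointUnion fun i => KBip 1 (m i))) 3 := by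
  refine not_hasRoleAssignment_disjointUnion_kBip hm (fun i => ?_) ?_
  · calc 2 ≤ ∑ j ∈ Finset.univ.erase i, 1 := by simp; omega
      _ ≤ _ := Finset.sum_le_sum fun j _ => hm j
  · rcases h4 with h4 | ⟨i, hi⟩
    · calc 4 ≤ ∑ j : Fin t, 1 := by simpa using h4
        _ ≤ _ := Finset.sum_le_sum fun j _ => hm j
    · have : ∑ j : Fin t, 1 < ∑ j, m j :=
        Finset.sum_lt_sum (fun j _ => hm j) ⟨i, Finset.mem_univ _, hi⟩
      simp at this
      omega

theorem not_hasRoleAssignment_two_stars {m₁ m₂ : ℕ} (h₁ : 2 ≤ m₁) (h₂ : 2 ≤ m₂) :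
    ¬ HasRoleAssignment (complementaryPrism (KBip 1 m₁ ⊕g KBip 1 m₂)) 3 := by
  intro h
  obtain ⟨e⟩ := isomorphic_disjointUnion_two (m := ![m₁, m₂])
  refine not_hasRoleAssignment_disjointUnion_kBip (m := ![m₁, m₂]) ?_ ?_ ?_
    (hasRoleAssignment_prism_of_iso e.symm h)
  · intro i; fin_cases i <;> simp <;> omega
  · have e0 : Finset.univ.erase (0 : Fin 2) = {1} := by decide
    have e1 : Finset.univ.erase (1 : Fin 2) = {0} := by decide
    intro i; fin_cases i
    · simpa [e0] using h₂
    · simpa [e1] using h₁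
  · simp; omega

end RoleAssignment

theorem mainTheorem2 {V : Type*} [Finite V] [Nonempty V] (G : SimpleGraph V)
    (hG : G.IsBipartite) :
    RoleAssignment.HasRoleAssignment (RoleAssignment.complementaryPrism G) 3 ↔
      ¬ (RoleAssignment.Isomorphic G (RoleAssignment.K 2) ∨
        (∃ n : ℕ, 2 ≤ n ∧ RoleAssignment.Isomorphic G ((RoleAssignment.K n)ᶜ)) ∨
        RoleAssignment.IsolatedCompleteBipartite G ∨
        (∃ t : ℕ, 4 ≤ t ∧ RoleAssignment.Isomorphic G
          (RoleAssignment.disjointUnion fun _ : Fin t => RoleAssignment.K 2)) ∨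
        (∃ (t : ℕ) (m : Fin t → ℕ), 3 ≤ t ∧ (∀ i, 1 ≤ m i) ∧ (∃ i, 2 ≤ m i) ∧
          RoleAssignment.Isomorphic G
            (RoleAssignment.disjointUnion fun i : Fin t => RoleAssignment.KBip 1 (m i))) ∨
        (∃ m₁ m₂ : ℕ, 2 ≤ m₁ ∧ 2 ≤ m₂ ∧ RoleAssignment.Isomorphic G
          (RoleAssignment.KBip 1 m₁ ⊕g RoleAssignment.KBip 1 m₂))) := by
  constructor
  · rintro h (⟨⟨e⟩⟩ | ⟨n, hn, ⟨e⟩⟩ | ⟨⟨i, hi⟩, hC, hne⟩ | ⟨t, ht, ⟨e⟩⟩ | ⟨t, m, ht, hm, hi, ⟨e⟩⟩ |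
      ⟨m₁, m₂, h₁, h₂, ⟨e⟩⟩)
    · exact RoleAssignment.not_hasRoleAssignment_K_two
        (RoleAssignment.hasRoleAssignment_prism_of_iso e h)
    · have hadj : ∀ v w, ¬ G.Adj v w := fun v w hvw => by
        simpa using e.map_adj_iff.2 hvw
      obtain ⟨i⟩ := ‹Nonempty V›
      -- Without edges the twin condition is vacuous, and the conclusion would produce an edge.
      obtain ⟨v, l, hvi, hli, hlv, hv⟩ := RoleAssignment.exists_star_of_isolated hG h
        (fun a _ n _ han => absurd han (hadj a n)) (hadj i)
      exact hadj v l (hv l hli hlv)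
    · obtain ⟨v, l, hvi, hli, hlv, hv⟩ := RoleAssignment.exists_star_of_isolated hG h
        (RoleAssignment.nbhdTwins_of_isomorphic_kBip hC) hi
      exact hne (RoleAssignment.isomorphic_K_one_sum_star
        (RoleAssignment.not_triangle_of_isBipartite hG) hi hvi hli hlv hv)
    · exact RoleAssignment.not_hasRoleAssignment_stars (m := fun _ => 1) (by omega) (by simp)
        (.inl ht) (RoleAssignment.hasRoleAssignment_prism_of_iso (e.trans
          (RoleAssignment.disjointUnionCongr (Equiv.refl _)
            fun _ => RoleAssignment.isoKBipOneOne.symm)) h)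
    · exact RoleAssignment.not_hasRoleAssignment_stars ht hm (.inr hi)
        (RoleAssignment.hasRoleAssignment_prism_of_iso e h)
    · exact RoleAssignment.not_hasRoleAssignment_two_stars h₁ h₂
        (RoleAssignment.hasRoleAssignment_prism_of_iso e h)
  · intro h
    simp only [not_or] at h
    -- The edgeless graphs are already covered by `IsolatedCompleteBipartite`, as they have no
    -- non-trivial component.
    obtain ⟨h1, -, h3, h4, h5, h6⟩ := h
    exact RoleAssignment.hasRoleAssignment_of_not_excluded hG h1 h3 h4 h5 h6
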